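/- Let $\mu\ge 1$, $d\ge 1$, $\Gamma=\mathbb Z^\mu$, and let $\mathcal A=\bigotimes_{x\in\Gamma}M_d(\mathbb C)$ be the quasi-local $C^*$-algebra of a quantum spin system on $\Gamma$, with local algebras $\mathcal A_\Lambda$ (for finite $\Lambda\subset\Gamma$), space translations $\tau_x$ ($x\in\Gamma$), and tracial state $\mathrm{tr}$. Let $\{h_x\}_{x\in\Gamma}$ be self-adjoint elements of $\mathcal A$ with uniformly bounded norms such that, for some $R$ and all $x$, $h_x$ belongs to the algebra of the box $\{y:\max_k|y_k-x_k|\le R\}$. For finite $\Lambda\subset\Gamma$ and $\beta\ge 0$, $t\in\mathbb R$ put $$H_\Lambda=\sum_{x\in\Lambda}h_x,\qquad \alpha_{\Lambda,t}(A)=e^{itH_\Lambda}Ae^{-itH_\Lambda},\qquad \rho^{\beta}_{\Lambda}(A)=\frac{\mathrm{tr}(e^{-\beta H_\Lambda}A)}{\mathrm{tr}(e^{-\beta H_\Lambda})},\qquad m_\Lambda(A)=\frac1{|\Lambda|}\sum_{x\in\Lambda}\tau_x(A)\quad(A\in\mathcal A).$$ Let $(\alpha_t)_{t\in\mathbb R}$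 be a strongly continuous one-parameter group of $*$-automorphisms of $\mathcal A$ that commutes with all $\tau_x$ and is approximately inner: $\alpha_{\Lambda,t}(A)\to\alpha_t(A)$ in norm as $\Lambda\uparrow\Gamma$, for all $A\in\mathcal A$ and $t\in\mathbb R$. Let $A_0,B_0$ be local elements of $\mathcal A$, and write $\widehat A_\Lambda=m_\Lambda(A_0)$, $\widehat B_\Lambda=m_\Lambda(B_0)$. Let $\varphi$ be a limiting Gibbs state, i.e. a state on $\mathcal A$ with $\rho^\beta_{\Lambda_1}(A)\to\varphi(A)$ for all $A\in\mathcal A$ along some net of finite sets $\Lambda_1\uparrow\Gamma$ (a net that eventually contains every finite subset of $\Gamma$). Assume that $\varphi$ is homogeneous, i.e. invariant under $\tau_x$ for all $x$ in some subgroup of finite index of $\Gamma$. Let $(\mathcal H_\varphi,\pi_\varphi,\Omega_\varphi)$ be the GNS triple of $\varphi$. A density of $A\in\mathcal A$ is an accumulation point, in the weak operator topology, of $\pi_\varphi(m_\Lambda(A))$ along finite sets $\Lambda\uparrow\Gamma$ in the sense of van Hove, which means that $\Lambda$ eventually contains every finite subset of $\Gamma$ and that for each $m$ the fraction of those $x\in\Lambda$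 for which the box of radius $m$ around $x$ is not contained in $\Lambda$ tends to $0$. Then, for every $t\in\mathbb R$, the temporal correlation $$f^{\varphi}_{A_0,B_0}(t)=\bigl\langle\Omega_\varphi,\ \widehat A^\varphi_\infty(t)\,\widehat B^\varphi_\infty\,\Omega_\varphi\bigr\rangle,$$ where $\widehat A^\varphi_\infty(t)$ is a density of $\alpha_t(A_0)$ and $\widehat B^\varphi_\infty$ is a density of $B_0$, is well defined (such densities exist, and the value does not depend on their choice), and $$\lim_{\Lambda_2\uparrow\Gamma}\ \lim_{\Lambda_1\uparrow\Gamma}\ \rho^{\beta}_{\Lambda_1}\bigl(\alpha_{\Lambda_2,t}(\widehat A_{\Lambda_2})\,\widehat B_{\Lambda_2}\bigr)=f^{\varphi}_{A_0,B_0}(t),$$ where both limits exist, the inner limit is taken along the given net $\Lambda_1\uparrow\Gamma$, and the outer limit is taken in the sense of van Hove. -/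

import Mathlib

open Filter Topology MeasureTheory

/-! ### The quantum spin algebra on the lattice `ℤ^μ` -/

/-- The lattice `ℤ^μ`. -/
abbrev Site (μ : ℕ) : Type := Fin μ → ℤ

/-- Classical configurations: a basis label in `Fin d` at every site. -/
abbrev Config (d μ : ℕ) : Type := Site μ → Fin d

/-- The Hilbert space `ℓ²` over all configurations, on which the spin algebra is represented
faithfully. Its standard basis vectors are written `δ_σ` below. -/
abbrev SpinSpace (d μ : ℕ) : Type := lp (fun _ : Config d μ => ℂ) 2

section PartialPullback

variable {I : Type}

/-- `f ↦ 1_s · (f ∘ e)` maps `ℓ²` to `ℓ²` and does not increase the norm,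
if `e` is injective on `s`. -/
theorem partialPullback_aux (s : Set I) (e : I → I) (he : Set.InjOn e s)
    (f : lp (fun _ : I => ℂ) 2) :
    ∃ h : Memℓp (E := fun _ : I => ℂ) (s.indicator (fun i => f (e i))) 2,
      ‖(⟨_, h⟩ : lp (fun _ : I => ℂ) 2)‖ ≤ ‖f‖ := by
  classical
  have h2 : (0 : ℝ) < (2 : ENNReal).toReal := by norm_num
  have hf : Summable fun i => ‖f i‖ ^ (2 : ENNReal).toReal :=
    (memℓp_gen_iff h2).1 (lp.memℓp f)
  have hsub : Summable fun i : s => ‖f (e i)‖ ^ (2 : ENNReal).toReal :=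
    hf.comp_injective (i := fun i : s => e i) he.injective
  have heq : (fun i => ‖s.indicator (fun i => f (e i)) i‖ ^ (2 : ENNReal).toReal)
      = s.indicator (fun i => ‖f (e i)‖ ^ (2 : ENNReal).toReal) := by
    funext i
    by_cases hi : i ∈ s
    · simp [hi]
    · simp [hi]
  have hsum : Summable fun i => ‖s.indicator (fun i => f (e i)) i‖ ^ (2 : ENNReal).toReal := by
    rw [heq]
    exact summable_subtype_iff_indicator.1 hsub
  refine ⟨memℓp_gen hsum, ?_⟩
  have key : ∑' i, ‖s.indicator (fun i => f (e i)) i‖ ^ (2 : ENNReal).toReal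
      ≤ ∑' i, ‖f i‖ ^ (2 : ENNReal).toReal := by
    rw [heq, ← tsum_subtype]
    exact tsum_comp_le_tsum_of_inj hf (fun i => by positivity)
      (i := fun i : s => e i) he.injective
  rw [lp.norm_eq_tsum_rpow h2, lp.norm_eq_tsum_rpow h2]
  exact Real.rpow_le_rpow (tsum_nonneg fun i => by positivity) key (by positivity)

/-- The operator `f ↦ 1_s · (f ∘ e)` on `ℓ²`, for `e` injective on `s`. -/
noncomputable def partialPullback (s : Set I) (e : I → I) (he : Set.InjOn e s) :
    lp (fun _ : I => ℂ) 2 →L[ℂ] lp (fun _ : I => ℂ) 2 :=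
  LinearMap.mkContinuous
    { toFun := fun f => ⟨_, (partialPullback_aux s e he f).choose⟩
      map_add' := fun f g => by
        ext i
        change s.indicator (fun i => f (e i) + g (e i)) i =
          s.indicator (fun i => f (e i)) i + s.indicator (fun i => g (e i)) i
        by_cases hi : i ∈ s <;> simp [hi]
      map_smul' := fun c f => by
        ext i
        change s.indicator (fun i => c • f (e i)) i = c • s.indicator (fun i => f (e i)) i
        by_cases hi : i ∈ s <;> simp [hi] } 1
    (fun f => by
      rw [one_mul]
      exact (partialPullback_aux s e he f).choose_spec)

theorem partialPullback_apply (s : Set I) (e : I → I) (he : Set.InjOn e s)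
    (f : lp (fun _ : I => ℂ) 2) (i : I) :
    partialPullback s e he f i = s.indicator (fun i => f (e i)) i := rfl

theorem partialPullback_norm_le (s : Set I) (e : I → I) (he : Set.InjOn e s)
    (f : lp (fun _ : I => ℂ) 2) : ‖partialPullback s e he f‖ ≤ ‖f‖ :=
  (partialPullback_aux s e he f).choose_spec

/-- The unitary `f ↦ f ∘ e` on `ℓ²`, for a permutation `e` of the index set. -/
noncomputable def permUnitary (e : Equiv.Perm I) :
    lp (fun _ : I => ℂ) 2 ≃ₗᵢ[ℂ] lp (fun _ : I => ℂ) 2 where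
  toFun := partialPullback Set.univ e e.injective.injOn
  map_add' := map_add _
  map_smul' := map_smul _
  invFun := partialPullback Set.univ e.symm e.symm.injective.injOn
  left_inv f := by
    ext i
    simp [partialPullback_apply]
  right_inv f := by
    ext i
    simp [partialPullback_apply]
  norm_map' f := by
    refine le_antisymm
      (partialPullback_norm_le Set.univ e e.injective.injOn f) ?_
    have h : partialPullback Set.univ e.symm e.symm.injective.injOn
        (partialPullback Set.univ e e.injective.injOn f) = f := by
      ext i
      simp [partialPullback_apply]
    have h' := partialPullback_norm_le Set.univ e.symm e.symm.injective.injOn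
      (partialPullback Set.univ e e.injective.injOn f)
    rw [h] at h'
    exact h'

theorem permUnitary_apply (e : Equiv.Perm I) (f : lp (fun _ : I => ℂ) 2) (i : I) :
    permUnitary e f i = f (e i) := by
  change partialPullback Set.univ e e.injective.injOn f i = _
  simp [partialPullback_apply]

theorem permUnitary_symm_apply (e : Equiv.Perm I) (f : lp (fun _ : I => ℂ) 2) (i : I) :
    (permUnitary e).symm f i = f (e.symm i) := by
  change partialPullback Set.univ e.symm e.symm.injective.injOn f i = _
  simp [partialPullback_apply]

end PartialPullback

variable {d μ : ℕ}

theorem updateInjOn (x : Site μ) (i j : Fin d) :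
    Set.InjOn (fun σ : Config d μ => Function.update σ x j) {σ | σ x = i} := by
  intro σ hσ σ' hσ' h
  funext y
  by_cases hy : y = x
  · subst hy
    rw [Set.mem_ofPred_eq] at hσ hσ'
    rw [hσ, hσ']
  · simpa [Function.update_of_ne hy] using congrFun h y

/-- The matrix unit `e_{ij}` of `M_d(ℂ)` acting on the tensor factor at the site `x`:
it maps `δ_σ` to `δ_{σ'}`, where `σ'` is `σ` with the label at `x` changed to `i`, if `σ x = j`,
and to `0` otherwise. -/
noncomputable def matrixUnit (x : Site μ) (i j : Fin d) :
    SpinSpace d μ →L[ℂ] SpinSpace d μ :=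
  partialPullback {σ : Config d μ | σ x = i} (fun σ => Function.update σ x j) (updateInjOn x i j)

/-- The algebra `𝒜_Λ` generated by the one-site matrix algebras `M_d(ℂ)` at the sites of `Λ`. -/
noncomputable def localAlgebra (d : ℕ) (Λ : Set (Site μ)) :
    StarSubalgebra ℂ (SpinSpace d μ →L[ℂ] SpinSpace d μ) :=
  StarAlgebra.adjoin ℂ {T | ∃ x ∈ Λ, ∃ i j : Fin d, T = matrixUnit x i j}

/-- The norm closure of the algebra generated by all one-site algebras. -/
noncomputable def quasiLocalAlgebra (d μ : ℕ) :
    StarSubalgebra ℂ (SpinSpace d μ →L[ℂ] SpinSpace d μ) :=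
  (localAlgebra d (Set.univ : Set (Site μ))).topologicalClosure

instance quasiLocalAlgebra_isClosed :
    IsClosed (quasiLocalAlgebra d μ : Set (SpinSpace d μ →L[ℂ] SpinSpace d μ)) :=
  StarSubalgebra.isClosed_topologicalClosure _

/-- The quasi-local C*-algebra `𝒜 = ⨂_{x ∈ ℤ^μ} M_d(ℂ)` of the quantum spin system. -/
abbrev SpinAlgebra (d μ : ℕ) : Type := quasiLocalAlgebra d μ

noncomputable instance : CStarAlgebra (SpinAlgebra d μ) :=
  StarSubalgebra.cstarAlgebra (quasiLocalAlgebra d μ)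

/-- `A` belongs to `𝒜_loc`, the union of the `𝒜_Λ` over finite `Λ`. -/
def IsLocal (A : SpinAlgebra d μ) : Prop :=
  ∃ Λ : Finset (Site μ), (A : SpinSpace d μ →L[ℂ] SpinSpace d μ) ∈ localAlgebra d (Λ : Set (Site μ))

/-- The shift `σ ↦ σ(· + x)` of configurations. -/
def shiftConfig (x : Site μ) : Equiv.Perm (Config d μ) where
  toFun σ := fun y => σ (y + x)
  invFun σ := fun y => σ (y - x)
  left_inv σ := by
    funext y
    simp
  right_inv σ := by
    funext y
    simp

/-- Conjugation by the unitary that moves the label at each site `y` to the site `y + x`. -/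
noncomputable def shiftConj (x : Site μ) :
    (SpinSpace d μ →L[ℂ] SpinSpace d μ) ≃⋆ₐ[ℂ] (SpinSpace d μ →L[ℂ] SpinSpace d μ) :=
  (permUnitary (shiftConfig (d := d) x)).conjStarAlgEquiv

theorem shiftConj_matrixUnit (x y : Site μ) (i j : Fin d) :
    shiftConj x (matrixUnit y i j) = matrixUnit (y + x) i j := by
  ext f σ
  change permUnitary (shiftConfig x) (matrixUnit y i j ((permUnitary (shiftConfig x)).symm f)) σ = _
  rw [permUnitary_apply]
  simp only [matrixUnit, partialPullback_apply]
  by_cases h : σ (y + x) = i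
  · rw [Set.indicator_of_mem (show shiftConfig x σ ∈ {σ : Config d μ | σ y = i} from h),
      Set.indicator_of_mem (show σ ∈ {σ : Config d μ | σ (y + x) = i} from h),
      permUnitary_symm_apply]
    refine congrArg (fun σ' => f σ') ?_
    funext z
    by_cases hz : z = y + x
    · subst hz
      simp [shiftConfig]
    · have hz' : z - x ≠ y := fun h' => hz (by rw [← h']; simp)
      simp [shiftConfig, Function.update_of_ne hz, Function.update_of_ne hz']
  · rw [Set.indicator_of_notMem (show shiftConfig x σ ∉ {σ : Config d μ | σ y = i} from h),
      Set.indicator_of_notMem (show σ ∉ {σ : Config d μ | σ (y + x) = i} from h)]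

theorem shiftConj_mem (x : Site μ) {T : SpinSpace d μ →L[ℂ] SpinSpace d μ}
    (hT : T ∈ quasiLocalAlgebra d μ) : shiftConj x T ∈ quasiLocalAlgebra d μ := by
  have hcont : Continuous (shiftConj (d := d) x) :=
    (StarAlgEquiv.isometry (shiftConj (d := d) x)).continuous
  have hle : localAlgebra d (Set.univ : Set (Site μ)) ≤
      (quasiLocalAlgebra d μ).comap
        (shiftConj (d := d) x : (SpinSpace d μ →L[ℂ] SpinSpace d μ) →⋆ₐ[ℂ]
          (SpinSpace d μ →L[ℂ] SpinSpace d μ)) := by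
    refine StarAlgebra.adjoin_le ?_
    rintro _ ⟨y, -, i, j, rfl⟩
    change shiftConj x (matrixUnit y i j) ∈ quasiLocalAlgebra d μ
    rw [shiftConj_matrixUnit]
    exact StarSubalgebra.le_topologicalClosure _
      (StarAlgebra.subset_adjoin ℂ _ ⟨y + x, Set.mem_univ _, i, j, rfl⟩)
  exact StarSubalgebra.topologicalClosure_minimal hle
    (quasiLocalAlgebra_isClosed.preimage hcont) hT

/-- The space translation `τ_x` of `𝒜`, which maps `𝒜_Λ` to `𝒜_{Λ + x}`. -/
noncomputable def translation (x : Site μ) : SpinAlgebra d μ →⋆ₐ[ℂ] SpinAlgebra d μ :=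
  StarAlgHom.codRestrict
    (((shiftConj (d := d) x : (SpinSpace d μ →L[ℂ] SpinSpace d μ) →⋆ₐ[ℂ]
      (SpinSpace d μ →L[ℂ] SpinSpace d μ))).comp (quasiLocalAlgebra d μ).subtype)
    (quasiLocalAlgebra d μ) (fun A => shiftConj_mem x A.2)

/-! ### Local Hamiltonians, local dynamics, local Gibbs states -/

/-- The box of the sites at distance at most `R` from `x` in the maximum norm. -/
def box (x : Site μ) (R : ℕ) : Set (Site μ) := {y | ∀ k, |y k - x k| ≤ (R : ℤ)}

/-- `h` is a family of self-adjoint elements `h_x`, each localized around `x`, with uniformly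
bounded range and uniformly bounded norm. -/
structure IsFiniteRange (h : Site μ → SpinAlgebra d μ) : Prop where
  selfAdjoint : ∀ x, IsSelfAdjoint (h x)
  range : ∃ R : ℕ, ∀ x,
    (h x : SpinSpace d μ →L[ℂ] SpinSpace d μ) ∈ localAlgebra d (box x R)
  bounded : ∃ N : ℝ, ∀ x, ‖h x‖ ≤ N

/-- `H_Λ = ∑_{x ∈ Λ} h_x`. -/
noncomputable def localHamiltonian (h : Site μ → SpinAlgebra d μ) (Λ : Finset (Site μ)) :
    SpinAlgebra d μ := ∑ x ∈ Λ, h x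

/-- `α_{Λ,t}(A) = e^{itH_Λ} A e^{-itH_Λ}`. -/
noncomputable def localEvolution (h : Site μ → SpinAlgebra d μ) (Λ : Finset (Site μ)) (t : ℝ)
    (A : SpinAlgebra d μ) : SpinAlgebra d μ :=
  NormedSpace.exp ((Complex.I * (t : ℂ)) • localHamiltonian h Λ) * A *
    NormedSpace.exp ((-(Complex.I * (t : ℂ))) • localHamiltonian h Λ)

/-- The uniform probability measure on `Fin d` at every site, independently. -/
noncomputable def uniformConfigMeasure (d μ : ℕ) : Measure (Config d μ) :=
  Measure.infinitePi (fun _ : Site μ => ProbabilityTheory.uniformOn (Set.univ : Set (Fin d)))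

/-- The tracial state of `𝒜`: the mean of the diagonal entries `⟨δ_σ, A δ_σ⟩`
over all configurations. For `A ∈ 𝒜_Λ` with `Λ` finite, an entry depends on the labels in `Λ` only,
and the mean is the normalized trace `d^{-|Λ|} Tr A`. -/
noncomputable def tracialState (A : SpinAlgebra d μ) : ℂ :=
  open scoped Classical in
  ∫ σ, inner ℂ (lp.single 2 σ (1 : ℂ) : SpinSpace d μ)
    ((A : SpinSpace d μ →L[ℂ] SpinSpace d μ) (lp.single 2 σ (1 : ℂ)))
    ∂(uniformConfigMeasure d μ)

/-- The local Gibbs state `A ↦ tr(e^{-βH_Λ} A) / tr(e^{-βH_Λ})`, on the whole of `𝒜`. -/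
noncomputable def gibbsState (h : Site μ → SpinAlgebra d μ) (β : ℝ) (Λ : Finset (Site μ))
    (A : SpinAlgebra d μ) : ℂ :=
  tracialState (NormedSpace.exp ((-(β : ℂ)) • localHamiltonian h Λ) * A) /
    tracialState (NormedSpace.exp ((-(β : ℂ)) • localHamiltonian h Λ))

/-! ### States and infinite-volume dynamics -/

open scoped ComplexOrder in
/-- A normalized positive linear functional. -/
def IsState (φ : SpinAlgebra d μ →ₗ[ℂ] ℂ) : Prop :=
  φ 1 = 1 ∧ ∀ A, 0 ≤ φ (star A * A)

/-- Invariance under the translations in a subgroup of finite index of `ℤ^μ`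
(translation invariance if the subgroup is `ℤ^μ` itself, spatial periodicity in general). -/
def IsHomogeneous (φ : SpinAlgebra d μ →ₗ[ℂ] ℂ) : Prop :=
  ∃ Δ : AddSubgroup (Site μ), Δ.FiniteIndex ∧ ∀ x ∈ Δ, ∀ A, φ (translation x A) = φ A

/-- A strongly continuous one-parameter group of *-automorphisms. -/
structure IsCStarDynamics (α : ℝ → (SpinAlgebra d μ ≃⋆ₐ[ℂ] SpinAlgebra d μ)) : Prop where
  zero : ∀ A, α 0 A = A
  add : ∀ s t A, α (s + t) A = α s (α t A)
  continuous : ∀ A, Tendsto (fun t => α t A) (𝓝 0) (𝓝 A)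

/-- The dynamics commutes with all space translations. -/
def IsTranslationInvariant (α : ℝ → (SpinAlgebra d μ ≃⋆ₐ[ℂ] SpinAlgebra d μ)) : Prop :=
  ∀ t x A, α t (translation x A) = translation x (α t A)

/-- `α_t(A)` is the norm limit of `α_{Λ,t}(A)` as `Λ ↑ ℤ^μ`. -/
def IsApproximatelyInner (h : Site μ → SpinAlgebra d μ)
    (α : ℝ → (SpinAlgebra d μ ≃⋆ₐ[ℂ] SpinAlgebra d μ)) : Prop :=
  ∀ t A, Tendsto (fun Λ => localEvolution h Λ t A) atTop (𝓝 (α t A))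

/-! ### Averages, van Hove limits, macroscopic observables -/

/-- `m_Λ(A) = |Λ|⁻¹ ∑_{x ∈ Λ} τ_x(A)`. -/
noncomputable def spaceAverage (Λ : Finset (Site μ)) (A : SpinAlgebra d μ) : SpinAlgebra d μ :=
  ((Λ.card : ℂ)⁻¹) • ∑ x ∈ Λ, translation x A

/-- The fraction of the sites of `Λ` whose surrounding box of radius `m` leaves `Λ`. -/
noncomputable def boundaryFraction (m : ℕ) (Λ : Finset (Site μ)) : ℝ :=
  (Set.ncard {x : Site μ | x ∈ Λ ∧ ¬ box x m ⊆ (Λ : Set (Site μ))} : ℝ) / (Λ.card : ℝ)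

/-- The van Hove limit: `Λ` eventually contains every finite set, and its boundary fractions
tend to zero. A net of finite sets tends to infinity in the sense of van Hove if and only if
it tends to this filter. -/
noncomputable def vanHove (μ : ℕ) : Filter (Finset (Site μ)) :=
  atTop ⊓ ⨅ m : ℕ, comap (boundaryFraction m) (𝓝 0)

section GNS

variable {E : Type*} [NormedAddCommGroup E] [InnerProductSpace ℂ E] [CompleteSpace E]

/-- `(E, π, Ω)` is the GNS triple of `φ`, which is unique up to unitary equivalence:
`Ω` is a cyclic vector and `φ(A) = ⟨Ω, π(A) Ω⟩`. -/
structure IsGNSTriple (φ : SpinAlgebra d μ →ₗ[ℂ] ℂ) (π : SpinAlgebra d μ →⋆ₐ[ℂ] (E →L[ℂ] E))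
    (Ω : E) : Prop where
  vector_state : ∀ A, φ A = inner ℂ Ω (π A Ω)
  cyclic : Dense (Set.range fun A => π A Ω)

/-- `a` is a macroscopic observable (density) of `A`: an accumulation point, in the weak operator
topology, of the averages `π(m_Λ(A))` as `Λ ↑ ℤ^μ`. -/
def IsDensity (π : SpinAlgebra d μ →⋆ₐ[ℂ] (E →L[ℂ] E)) (A : SpinAlgebra d μ) (a : E →L[ℂ] E) :
    Prop :=
  MapClusterPt (ContinuousLinearMapWOT.ofCLM a : E →WOT[ℂ] E) (vanHove μ)
    (fun Λ => ContinuousLinearMapWOT.ofCLM (π (spaceAverage Λ A)))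

/-- The possible values of the temporal correlation function `⟨Ω, Â_∞(t) B̂_∞ Ω⟩`, where `Â_∞(t)`
is a density of `α_t(A)` and `B̂_∞` is a density of `B`. -/
def temporalCorrelations (π : SpinAlgebra d μ →⋆ₐ[ℂ] (E →L[ℂ] E)) (Ω : E)
    (α : ℝ → (SpinAlgebra d μ ≃⋆ₐ[ℂ] SpinAlgebra d μ)) (A B : SpinAlgebra d μ) (t : ℝ) : Set ℂ :=
  {z | ∃ a b : E →L[ℂ] E, IsDensity π (α t A) a ∧ IsDensity π B b ∧ z = inner ℂ Ω (a (b Ω))}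

end GNS

/-!
By the mean ergodic theorem in the GNS space, the vectors `π(m_Λ(A)) Ω` converge in the sense of
van Hove. Averages of local observables commute asymptotically with every element of `𝒜`, so
`π(m_Λ(A)) π(C) Ω` converges for all `C`; as `Ω` is cyclic and the averages are bounded by `‖A‖`,
the operators `π(m_Λ(A))` converge strongly, and their limit is the only density of `A`.

It remains to see that `α_{Λ,t}(m_Λ(A)) - m_Λ(α_t(A))` tends to `0` in norm. For small `|t|` the
series of iterated commutators with `H_Λ` converges geometrically, at a rate that depends neither on
`Λ` nor on the site around which the observable is localized, and by finite range its terms do not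
see `Λ` when that site lies deep inside `Λ`. Composing small time steps, this makes the convergence
`α_{Λ,t}(τ_x A) → α_t(τ_x A)` uniform in the sites `x` deep inside `Λ`, while the fraction of the
other sites tends to `0`.
-/

/-! ### Local algebras -/

theorem matrixUnit_apply (x : Site μ) (i j : Fin d) (f : SpinSpace d μ) (σ : Config d μ) :
    matrixUnit x i j f σ = if σ x = i then f (Function.update σ x j) else 0 := by
  simp [matrixUnit, partialPullback_apply, Set.indicator_apply]

theorem matrixUnit_commute {x y : Site μ} (hxy : x ≠ y) (i j k l : Fin d) :
    Commute (matrixUnit x i j) (matrixUnit y k l) := by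
  ext f σ
  simp only [mul_apply_eq_comp, matrixUnit_apply, Function.update_of_ne hxy,
    Function.update_of_ne hxy.symm, Function.update_comm hxy]
  split_ifs <;> rfl

open scoped Classical in
theorem matrixUnit_single (x : Site μ) (i j : Fin d) (σ : Config d μ) :
    matrixUnit x i j (lp.single 2 σ (1 : ℂ)) =
      if σ x = j then lp.single 2 (Function.update σ x i) (1 : ℂ) else 0 := by
  ext ρ
  have key : (ρ x = i ∧ Function.update ρ x j = σ) ↔
      (σ x = j ∧ ρ = Function.update σ x i) := by
    constructor <;> rintro ⟨h, rfl⟩ <;> simp [← h]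
  have hleft : matrixUnit x i j (lp.single 2 σ (1 : ℂ)) ρ =
      if ρ x = i ∧ Function.update ρ x j = σ then 1 else 0 := by
    simp [matrixUnit_apply, Pi.single_apply, ite_and]
  rw [hleft, if_congr key rfl rfl, ite_and]
  split_ifs <;> simp_all

theorem star_matrixUnit (x : Site μ) (i j : Fin d) :
    star (matrixUnit x i j) = matrixUnit x j i := by
  classical
  ext f σ
  have inner_single (g : SpinSpace d μ) (ρ : Config d μ) :
      inner ℂ (lp.single 2 ρ (1 : ℂ) : SpinSpace d μ) g = g ρ := by
    simp [lp.inner_single_left]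
  rw [← inner_single, ContinuousLinearMap.star_eq_adjoint,
    ContinuousLinearMap.adjoint_inner_right, matrixUnit_single, matrixUnit_apply]
  split_ifs
  · rw [inner_single]
  · simp

theorem matrixUnit_mem_localAlgebra {S : Set (Site μ)} {x : Site μ} (hx : x ∈ S) (i j : Fin d) :
    matrixUnit x i j ∈ localAlgebra d S :=
  StarAlgebra.subset_adjoin ℂ _ ⟨x, hx, i, j, rfl⟩

theorem localAlgebra_mono {S T : Set (Site μ)} (h : S ⊆ T) :
    localAlgebra d S ≤ localAlgebra d T :=
  StarAlgebra.adjoin_mono fun _ ⟨x, hx, i, j, hT⟩ => ⟨x, h hx, i, j, hT⟩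

theorem localAlgebra_le_centralizer {S T : Set (Site μ)} (hST : Disjoint S T) :
    localAlgebra d S ≤ StarSubalgebra.centralizer ℂ (localAlgebra d T) := by
  have hgen : localAlgebra d T ≤ StarSubalgebra.centralizer ℂ
      {A | ∃ x ∈ S, ∃ i j : Fin d, A = matrixUnit x i j} := by
    refine StarAlgebra.adjoin_le ?_
    rintro _ ⟨y, hy, k, l, rfl⟩
    refine (StarSubalgebra.mem_centralizer_iff ℂ).2 ?_
    rintro _ ⟨x, hx, i, j, rfl⟩
    have hxy : x ≠ y := hST.ne_of_mem hx hy
    rw [star_matrixUnit]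
    exact ⟨matrixUnit_commute hxy i j k l, matrixUnit_commute hxy j i k l⟩
  exact (StarAlgebra.adjoin_le_centralizer_centralizer ℂ _).trans
    (StarSubalgebra.centralizer_le _ _ _ hgen)

theorem localAlgebra_univ_le_iSup : localAlgebra d (Set.univ : Set (Site μ)) ≤
    ⨆ Λ : Finset (Site μ), localAlgebra d (Λ : Set (Site μ)) := by
  refine StarAlgebra.adjoin_le ?_
  rintro _ ⟨x, -, i, j, rfl⟩
  exact le_iSup (fun Λ : Finset (Site μ) => localAlgebra d (Λ : Set (Site μ))) {x}
    (matrixUnit_mem_localAlgebra (by simp) i j)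

theorem shiftConj_mem_localAlgebra {S : Set (Site μ)} {T : SpinSpace d μ →L[ℂ] SpinSpace d μ}
    (hT : T ∈ localAlgebra d S) (x : Site μ) :
    shiftConj x T ∈ localAlgebra d ((· + x) '' S) := by
  have hle : localAlgebra d S ≤ (localAlgebra d ((· + x) '' S)).comap
      (shiftConj (d := d) x : (SpinSpace d μ →L[ℂ] SpinSpace d μ) →⋆ₐ[ℂ]
        (SpinSpace d μ →L[ℂ] SpinSpace d μ)) := by
    refine StarAlgebra.adjoin_le ?_
    rintro _ ⟨y, hy, i, j, rfl⟩
    change shiftConj x (matrixUnit y i j) ∈ localAlgebra d ((· + x) '' S)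
    rw [shiftConj_matrixUnit]
    exact matrixUnit_mem_localAlgebra (Set.mem_image_of_mem _ hy) i j
  exact hle hT

/-- The local algebra of `S`, viewed inside the quasi-local algebra. -/
noncomputable def localSubalgebra (d : ℕ) (S : Set (Site μ)) : StarSubalgebra ℂ (SpinAlgebra d μ) :=
  (localAlgebra d S).comap (quasiLocalAlgebra d μ).subtype

theorem localSubalgebra_mono {S T : Set (Site μ)} (h : S ⊆ T) :
    localSubalgebra d S ≤ localSubalgebra d T :=
  fun _ hA => localAlgebra_mono h hA

theorem commute_of_mem_localSubalgebra {S T : Set (Site μ)} (hST : Disjoint S T)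
    {A B : SpinAlgebra d μ} (hA : A ∈ localSubalgebra d S) (hB : B ∈ localSubalgebra d T) :
    Commute A B :=
  Subtype.ext
    ((StarSubalgebra.mem_centralizer_iff ℂ).1 (localAlgebra_le_centralizer hST hA) _ hB).1.symm

theorem translation_mem_localSubalgebra {S : Set (Site μ)} {A : SpinAlgebra d μ}
    (hA : A ∈ localSubalgebra d S) (x : Site μ) :
    translation x A ∈ localSubalgebra d ((· + x) '' S) :=
  shiftConj_mem_localAlgebra hA x

theorem dense_isLocal : Dense {A : SpinAlgebra d μ | IsLocal A} := by
  have hdir : Directed (· ≤ ·) fun Λ : Finset (Site μ) => localAlgebra d (Λ : Set (Site μ)) :=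
    Monotone.directed_le fun _ _ h => localAlgebra_mono (Finset.coe_subset.2 h)
  intro A
  rw [Metric.mem_closure_iff]
  intro ε hε
  obtain ⟨T, hT, hAT⟩ := Metric.mem_closure_iff.1 A.2 ε hε
  have hlocal := localAlgebra_univ_le_iSup hT
  rw [← SetLike.mem_coe, StarSubalgebra.coe_iSup_of_directed hdir, Set.mem_iUnion] at hlocal
  exact ⟨⟨T, StarSubalgebra.le_topologicalClosure _ hT⟩, hlocal, hAT⟩

/-! ### Translations -/

theorem permUnitary_shiftConfig_trans (x y : Site μ) :
    (permUnitary (shiftConfig (d := d) y)).trans (permUnitary (shiftConfig x)) =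
      permUnitary (shiftConfig (y + x)) := by
  ext f σ
  simp [permUnitary_apply, shiftConfig, add_assoc]

theorem translation_translation (x y : Site μ) (A : SpinAlgebra d μ) :
    translation x (translation y A) = translation (y + x) A := by
  refine Subtype.ext ?_
  change ((permUnitary (shiftConfig (d := d) y)).trans
    (permUnitary (shiftConfig x))).conjStarAlgEquiv (A : SpinSpace d μ →L[ℂ] SpinSpace d μ) =
    shiftConj (y + x) (A : SpinSpace d μ →L[ℂ] SpinSpace d μ)
  rw [permUnitary_shiftConfig_trans, shiftConj]

theorem norm_translation_le (x : Site μ) (A : SpinAlgebra d μ) : ‖translation x A‖ ≤ ‖A‖ :=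
  NonUnitalStarAlgHom.norm_apply_le (translation x) A

/-! ### Averages over finite sets -/

theorem norm_inv_card_smul_sum_le {ι F : Type*} [NormedAddCommGroup F] [NormedSpace ℂ F]
    (Λ : Finset ι) (v : ι → F) {C : ℝ} (hC : 0 ≤ C) (hv : ∀ x ∈ Λ, ‖v x‖ ≤ C) :
    ‖(Λ.card : ℂ)⁻¹ • ∑ x ∈ Λ, v x‖ ≤ C := by
  rcases Λ.eq_empty_or_nonempty with rfl | hΛ
  · simpa using hC
  have hpos : (0 : ℝ) < Λ.card := by exact_mod_cast hΛ.card_pos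
  rw [norm_smul, norm_inv, Complex.norm_natCast, inv_mul_le_iff₀ hpos]
  simpa using norm_sum_le_of_le Λ hv

theorem spaceAverage_add (Λ : Finset (Site μ)) (A B : SpinAlgebra d μ) :
    spaceAverage Λ (A + B) = spaceAverage Λ A + spaceAverage Λ B := by
  simp [spaceAverage, Finset.sum_add_distrib]

theorem spaceAverage_smul (Λ : Finset (Site μ)) (c : ℂ) (A : SpinAlgebra d μ) :
    spaceAverage Λ (c • A) = c • spaceAverage Λ A := by
  simp only [spaceAverage, map_smul, ← Finset.smul_sum]
  rw [smul_comm]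

theorem spaceAverage_sub (Λ : Finset (Site μ)) (A B : SpinAlgebra d μ) :
    spaceAverage Λ (A - B) = spaceAverage Λ A - spaceAverage Λ B := by
  simp [spaceAverage, Finset.sum_sub_distrib, smul_sub]

theorem norm_spaceAverage_le (Λ : Finset (Site μ)) (A : SpinAlgebra d μ) :
    ‖spaceAverage Λ A‖ ≤ ‖A‖ :=
  norm_inv_card_smul_sum_le Λ _ (norm_nonneg A) fun x _ => norm_translation_le x A

theorem translation_spaceAverage (z : Site μ) (Λ : Finset (Site μ)) (A : SpinAlgebra d μ) :
    translation z (spaceAverage Λ A) = spaceAverage Λ (translation z A) := by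
  simp only [spaceAverage, map_smul, map_sum, translation_translation, add_comm z]

/-! ### Boxes and van Hove limits -/

theorem box_mono (x : Site μ) {m n : ℕ} (h : m ≤ n) : box x m ⊆ box x n :=
  fun _ hz k => (hz k).trans (by exact_mod_cast h)

theorem box_subset_box {x y : Site μ} {m n : ℕ} (hy : y ∈ box x n) :
    box y m ⊆ box x (n + m) := fun z hz k => by
  rw [← sub_add_sub_cancel (z k) (y k) (x k)]
  push_cast
  exact (abs_add_le _ _).trans (by linarith [hz k, hy k])

theorem mem_box_comm {x y : Site μ} {m : ℕ} : x ∈ box y m ↔ y ∈ box x m :=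
  forall_congr' fun k => by rw [abs_sub_comm]

/-- The box `box x m` as a finite set. -/
noncomputable def finBox (x : Site μ) (m : ℕ) : Finset (Site μ) :=
  Finset.Icc (fun k => x k - m) (fun k => x k + m)

theorem mem_finBox {x y : Site μ} {m : ℕ} : y ∈ finBox x m ↔ y ∈ box x m := by
  simp only [finBox, Finset.mem_Icc, Pi.le_def, box, Set.mem_ofPred_eq, abs_le, ← forall_and]
  exact forall_congr' fun k => by omega

theorem coe_finBox (x : Site μ) (m : ℕ) : (finBox x m : Set (Site μ)) = box x m :=
  Set.ext fun _ => mem_finBox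

theorem card_finBox (x : Site μ) (m : ℕ) : (finBox x m).card = (2 * m + 1) ^ μ := by
  have h (k : Fin μ) : (x k + m + 1 - (x k - m)).toNat = 2 * m + 1 := by omega
  simp [finBox, Pi.card_Icc, h]

theorem exists_subset_box (S : Finset (Site μ)) : ∃ m : ℕ, (S : Set (Site μ)) ⊆ box 0 m := by
  refine ⟨S.sup fun y => Finset.univ.sup fun k => (y k).natAbs, fun y hy k => ?_⟩
  have hk : (y k).natAbs ≤ Finset.univ.sup fun k => (y k).natAbs :=
    Finset.le_sup (f := fun k => (y k).natAbs) (Finset.mem_univ k)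
  have hS := hk.trans (Finset.le_sup (f := fun y : Site μ => Finset.univ.sup fun k =>
    (y k).natAbs) hy)
  rw [Pi.zero_apply, sub_zero, ← Int.natCast_natAbs]
  exact_mod_cast hS

theorem vanHove_le_atTop : vanHove μ ≤ atTop := inf_le_left

theorem tendsto_boundaryFraction (m : ℕ) :
    Tendsto (boundaryFraction (μ := μ) m) (vanHove μ) (𝓝 0) :=
  tendsto_comap.mono_left (inf_le_right.trans (iInf_le _ m))

theorem tendsto_finBox_atTop : Tendsto (fun n : ℕ => finBox (0 : Site μ) n) atTop atTop := by
  refine tendsto_atTop.2 fun S => ?_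
  obtain ⟨m, hm⟩ := exists_subset_box S
  filter_upwards [eventually_ge_atTop m] with n hn
  rw [← Finset.coe_subset, coe_finBox]
  exact hm.trans (box_mono 0 hn)

theorem boundaryFraction_finBox_le (m n : ℕ) :
    boundaryFraction m (finBox (0 : Site μ) (n + m)) ≤
      1 - ((2 * n + 1) / (2 * (n + m) + 1)) ^ μ := by
  have hsub : {x : Site μ | x ∈ finBox 0 (n + m) ∧ ¬ box x m ⊆ finBox (0 : Site μ) (n + m)} ⊆
      ((finBox 0 (n + m) \ finBox 0 n : Finset (Site μ)) : Set (Site μ)) := by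
    rintro x ⟨hx, hx'⟩
    rw [Finset.coe_sdiff]
    refine ⟨hx, fun h => hx' ?_⟩
    rw [coe_finBox] at h ⊢
    exact box_subset_box h
  have hmono : finBox (0 : Site μ) n ⊆ finBox 0 (n + m) := by
    rw [← Finset.coe_subset, coe_finBox, coe_finBox]
    exact box_mono 0 (Nat.le_add_right n m)
  have hcard := Nat.cast_le (α := ℝ).2 (Set.ncard_le_ncard hsub (Finset.finite_toSet _))
  rw [Set.ncard_coe_finset, Finset.card_sdiff_of_subset hmono,
    Nat.cast_sub (Finset.card_le_card hmono), card_finBox, card_finBox] at hcard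
  push_cast at hcard
  have hpos : (0 : ℝ) < (2 * (n + m) + 1) ^ μ := by positivity
  rw [boundaryFraction, card_finBox, div_pow]
  push_cast
  rwa [div_le_iff₀ hpos, sub_mul, div_mul_cancel₀ _ hpos.ne', one_mul]

theorem tendsto_finBox_vanHove :
    Tendsto (fun n : ℕ => finBox (0 : Site μ) n) atTop (vanHove μ) := by
  refine tendsto_inf.2 ⟨tendsto_finBox_atTop, tendsto_iInf.2 fun m => tendsto_comap_iff.2 ?_⟩
  refine (tendsto_add_atTop_iff_nat m).1 ?_
  have hratio : Tendsto (fun n : ℕ => ((2 * n + 1) / (2 * (n + m) + 1) : ℝ)) atTop (𝓝 1) := by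
    have hinv : Tendsto (fun n : ℕ => (2 * (n + m) + 1 : ℝ)⁻¹) atTop (𝓝 0) := by
      refine tendsto_inv_atTop_zero.comp (tendsto_atTop_mono (fun n => ?_)
        tendsto_natCast_atTop_atTop)
      linarith [(n.cast_nonneg : (0 : ℝ) ≤ n), (m.cast_nonneg : (0 : ℝ) ≤ m)]
    have hlim := (hinv.const_mul (2 * m : ℝ)).const_sub 1
    rw [mul_zero, sub_zero] at hlim
    refine hlim.congr fun n => ?_
    field_simp
    ring
  have hlim := (hratio.pow μ).const_sub 1
  rw [one_pow, sub_self] at hlim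
  exact squeeze_zero (fun n => by unfold Function.comp boundaryFraction; positivity)
    (fun n => boundaryFraction_finBox_le m n) hlim

instance vanHove_neBot : (vanHove μ).NeBot := tendsto_finBox_vanHove.neBot

theorem tendsto_inv_card_vanHove (hμ : 1 ≤ μ) :
    Tendsto (fun Λ : Finset (Site μ) => (Λ.card : ℂ)⁻¹) (vanHove μ) (𝓝 0) := by
  have : Nonempty (Fin μ) := ⟨⟨0, hμ⟩⟩
  exact (tendsto_inv_atTop_nhds_zero_nat (𝕜 := ℂ)).comp
    (tendsto_card_atTop_atTop.mono_left vanHove_le_atTop)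

theorem card_translate_sdiff_le (Λ : Finset (Site μ)) {z : Site μ} {m : ℕ} (hz : z ∈ box 0 m) :
    (Λ.map (addLeftEmbedding z) \ Λ).card ≤
      Set.ncard {x : Site μ | x ∈ Λ ∧ ¬ box x m ⊆ (Λ : Set (Site μ))} := by
  rw [← Set.ncard_coe_finset]
  refine Set.ncard_le_ncard_of_injOn (· - z) ?_ (fun _ _ _ _ h => sub_left_injective h)
    (Λ.finite_toSet.subset fun x hx => hx.1)
  intro y hy
  obtain ⟨hy, hyΛ⟩ := Finset.mem_sdiff.1 hy
  obtain ⟨x, hx, rfl⟩ := Finset.mem_map.1 hy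
  simp only [addLeftEmbedding_apply, add_sub_cancel_left] at hyΛ ⊢
  exact ⟨hx, fun hsub => hyΛ (hsub fun k => by simpa using hz k)⟩

theorem norm_spaceAverage_translation_sub_le (Λ : Finset (Site μ)) {z : Site μ} {m : ℕ}
    (hz : z ∈ box 0 m) (A : SpinAlgebra d μ) :
    ‖spaceAverage Λ (translation z A) - spaceAverage Λ A‖ ≤ 2 * ‖A‖ * boundaryFraction m Λ := by
  set Λ' : Finset (Site μ) := Λ.map (addLeftEmbedding z)
  have hsum : ∑ x ∈ Λ, translation x (translation z A) = ∑ x ∈ Λ', translation x A := by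
    simp [Λ', translation_translation]
  have hcard : (Λ \ Λ').card = (Λ' \ Λ).card := Finset.card_sdiff_comm (by simp [Λ'])
  have hnorm (T : Finset (Site μ)) : ‖∑ x ∈ T, translation x A‖ ≤ T.card * ‖A‖ := by
    simpa using norm_sum_le_of_le T fun x _ => norm_translation_le x A
  have hbd : ((Λ' \ Λ).card : ℝ) ≤
      Set.ncard {x : Site μ | x ∈ Λ ∧ ¬ box x m ⊆ (Λ : Set (Site μ))} :=
    Nat.cast_le.2 (card_translate_sdiff_le Λ hz)
  rw [spaceAverage, spaceAverage, hsum, ← smul_sub, ← Finset.sum_sdiff_sub_sum_sdiff, norm_smul,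
    norm_inv, Complex.norm_natCast, boundaryFraction, ← mul_div_assoc, div_eq_inv_mul]
  gcongr
  calc ‖∑ x ∈ Λ' \ Λ, translation x A - ∑ x ∈ Λ \ Λ', translation x A‖
      ≤ (Λ' \ Λ).card * ‖A‖ + (Λ \ Λ').card * ‖A‖ :=
        (norm_sub_le _ _).trans (add_le_add (hnorm _) (hnorm _))
    _ = 2 * ‖A‖ * (Λ' \ Λ).card := by rw [hcard]; ring
    _ ≤ _ := by gcongr

theorem tendsto_spaceAverage_translation_sub (z : Site μ) (A : SpinAlgebra d μ) :
    Tendsto (fun Λ => spaceAverage Λ (translation z A) - spaceAverage Λ A) (vanHove μ) (𝓝 0) := by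
  obtain ⟨m, hm⟩ := exists_subset_box {z}
  refine squeeze_zero_norm (fun Λ => norm_spaceAverage_translation_sub_le Λ (hm (by simp)) A) ?_
  simpa using (tendsto_boundaryFraction m).const_mul (2 * ‖A‖)

/-! ### Sites deep inside a finite set -/

/-- The filter on pairs `(Λ, x)` that describes `x` lying ever deeper inside `Λ`. Convergence along
it is convergence uniform in the sites far away from the complement of `Λ`. -/
def interiorFilter (μ : ℕ) : Filter (Finset (Site μ) × Site μ) :=
  ⨅ m : ℕ, 𝓟 {p | box p.2 m ⊆ (p.1 : Set (Site μ))}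

theorem eventually_interiorFilter {P : Finset (Site μ) × Site μ → Prop} :
    (∀ᶠ p in interiorFilter μ, P p) ↔
      ∃ m : ℕ, ∀ p : Finset (Site μ) × Site μ, box p.2 m ⊆ (p.1 : Set (Site μ)) → P p := by
  have hanti : Antitone fun m : ℕ =>
      {p : Finset (Site μ) × Site μ | box p.2 m ⊆ (p.1 : Set (Site μ))} :=
    fun m n hmn p hp => (box_mono p.2 hmn).trans hp
  simpa [interiorFilter] using
    (hasBasis_iInf_principal hanti.directed_ge).eventually_iff (q := P)

theorem eventually_box_subset (m : ℕ) :
    ∀ᶠ p in interiorFilter μ, box p.2 m ⊆ (p.1 : Set (Site μ)) :=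
  eventually_interiorFilter.2 ⟨m, fun _ => id⟩

theorem tendsto_prodMk_interiorFilter (x : Site μ) :
    Tendsto (fun Λ : Finset (Site μ) => (Λ, x)) atTop (interiorFilter μ) := by
  refine tendsto_iInf.2 fun m => tendsto_principal.2 ?_
  filter_upwards [eventually_ge_atTop (finBox x m)] with Λ hΛ
  simpa [← coe_finBox] using hΛ

theorem norm_inv_card_smul_sum_le_add_boundaryFraction {F : Type*} [NormedAddCommGroup F]
    [NormedSpace ℂ F] (Λ : Finset (Site μ)) {v : Site μ → F} {m : ℕ} {ε K : ℝ} (hε : 0 ≤ ε)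
    (hv : ∀ x ∈ Λ, box x m ⊆ (Λ : Set (Site μ)) → ‖v x‖ ≤ ε) (hK : ∀ x ∈ Λ, ‖v x‖ ≤ K) :
    ‖(Λ.card : ℂ)⁻¹ • ∑ x ∈ Λ, v x‖ ≤ ε + K * boundaryFraction m Λ := by
  classical
  rcases Λ.eq_empty_or_nonempty with rfl | hΛ
  · simpa [boundaryFraction] using hε
  have hpos : (0 : ℝ) < Λ.card := by exact_mod_cast hΛ.card_pos
  have hbd : ({x : Site μ | x ∈ Λ ∧ ¬ box x m ⊆ (Λ : Set (Site μ))}) =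
      (Λ.filter fun x => ¬ box x m ⊆ (Λ : Set (Site μ)) : Finset (Site μ)) := by
    ext; simp
  have hterm : ∀ x ∈ Λ, ‖v x‖ ≤ ε + if ¬ box x m ⊆ (Λ : Set (Site μ)) then K else 0 := by
    intro x hx
    split_ifs with hbox
    · simpa using hv x hx hbox
    · linarith [hK x hx]
  rw [norm_smul, norm_inv, Complex.norm_natCast, inv_mul_le_iff₀ hpos, boundaryFraction, hbd,
    Set.ncard_coe_finset]
  refine (norm_sum_le_of_le Λ hterm).trans_eq ?_
  rw [Finset.sum_add_distrib, Finset.sum_const, ← Finset.sum_filter, Finset.sum_const,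
    nsmul_eq_mul, nsmul_eq_mul]
  field_simp

theorem tendsto_inv_card_smul_sum_vanHove {F : Type*} [NormedAddCommGroup F] [NormedSpace ℂ F]
    {v : Finset (Site μ) × Site μ → F} {K : ℝ} (hK : ∀ p, ‖v p‖ ≤ K)
    (hv : Tendsto v (interiorFilter μ) (𝓝 0)) :
    Tendsto (fun Λ => (Λ.card : ℂ)⁻¹ • ∑ x ∈ Λ, v (Λ, x)) (vanHove μ) (𝓝 0) := by
  rw [NormedAddGroup.tendsto_nhds_zero] at hv ⊢
  intro ε hε
  obtain ⟨m, hm⟩ := eventually_interiorFilter.1 (hv (ε / 2) (half_pos hε))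
  have hlim : Tendsto (fun Λ => ε / 2 + K * boundaryFraction (μ := μ) m Λ) (vanHove μ)
      (𝓝 (ε / 2)) := by
    simpa using ((tendsto_boundaryFraction m).const_mul K).const_add (ε / 2)
  filter_upwards [hlim.eventually_lt_const (half_lt_self hε)] with Λ hΛ
  exact (norm_inv_card_smul_sum_le_add_boundaryFraction Λ (half_pos hε).le
    (fun x _ hx => (hm (Λ, x) hx).le) fun x _ => hK (Λ, x)).trans_lt hΛ

/-! ### Asymptotic commutativity of averages -/

attribute [local instance] LieRing.ofAssociativeRing

theorem norm_lie_le {𝔸 : Type*} [NonUnitalSeminormedRing 𝔸] (a b : 𝔸) :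
    ‖⁅a, b⁆‖ ≤ 2 * ‖a‖ * ‖b‖ := by
  rw [Ring.lie_def]
  refine (norm_sub_le _ _).trans ?_
  linarith [norm_mul_le a b, norm_mul_le b a, mul_comm ‖a‖ ‖b‖]

theorem lie_spaceAverage_left (Λ : Finset (Site μ)) (A C : SpinAlgebra d μ) :
    ⁅spaceAverage Λ A, C⁆ = (Λ.card : ℂ)⁻¹ • ∑ x ∈ Λ, ⁅translation x A, C⁆ := by
  rw [spaceAverage, smul_lie, sum_lie]

theorem tendsto_lie_spaceAverage_of_isLocal (hμ : 1 ≤ μ) {A C : SpinAlgebra d μ}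
    (hA : IsLocal A) (hC : IsLocal C) :
    Tendsto (fun Λ => ⁅spaceAverage Λ A, C⁆) (vanHove μ) (𝓝 0) := by
  classical
  obtain ⟨S, hS⟩ := hA
  obtain ⟨T, hT⟩ := hC
  let U : Finset (Site μ) := Finset.image₂ (fun t s => t - s) T S
  have hcomm : ∀ x ∉ U, ⁅translation x A, C⁆ = 0 := by
    intro x hx
    refine (commute_of_mem_localSubalgebra (Set.disjoint_left.2 ?_)
      (translation_mem_localSubalgebra hS x) hT).lie_eq
    rintro _ ⟨s, hs, rfl⟩ ht
    exact hx (Finset.mem_image₂.2 ⟨s + x, ht, s, hs, by simp⟩)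
  have hlim := (tendsto_inv_card_vanHove hμ).smul_const (∑ x ∈ U, ⁅translation x A, C⁆)
  rw [zero_smul] at hlim
  refine hlim.congr' ?_
  filter_upwards [vanHove_le_atTop (eventually_ge_atTop U)] with Λ hΛ
  rw [lie_spaceAverage_left, Finset.sum_subset hΛ fun x _ hx => hcomm x hx]

theorem tendsto_lie_spaceAverage (hμ : 1 ≤ μ) (A C : SpinAlgebra d μ) :
    Tendsto (fun Λ => ⁅spaceAverage Λ A, C⁆) (vanHove μ) (𝓝 0) := by
  have hlip_right (A : SpinAlgebra d μ) (Λ : Finset (Site μ)) :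
      LipschitzWith (2 * ‖A‖₊) fun C : SpinAlgebra d μ => ⁅spaceAverage Λ A, C⁆ := by
    refine LipschitzWith.of_dist_le_mul fun C C' => ?_
    rw [dist_eq_norm, dist_eq_norm, ← lie_sub]
    refine (norm_lie_le _ _).trans ?_
    simpa using by gcongr; exact norm_spaceAverage_le Λ A
  have hlip_left (C : SpinAlgebra d μ) (Λ : Finset (Site μ)) :
      LipschitzWith (2 * ‖C‖₊) fun A : SpinAlgebra d μ => ⁅spaceAverage Λ A, C⁆ := by
    refine LipschitzWith.of_dist_le_mul fun A A' => ?_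
    rw [dist_eq_norm, dist_eq_norm, ← sub_lie, ← spaceAverage_sub]
    refine (norm_lie_le _ _).trans ?_
    rw [mul_right_comm]
    simpa using by gcongr; exact norm_spaceAverage_le Λ (A - A')
  have hlocal {C : SpinAlgebra d μ} (hC : IsLocal C) (A : SpinAlgebra d μ) :
      Tendsto (fun Λ => ⁅spaceAverage Λ A, C⁆) (vanHove μ) (𝓝 0) := by
    have hequi := (LipschitzWith.uniformEquicontinuous _ _ (hlip_left C)).equicontinuous
    exact (hequi.isClosed_setOfPred_tendsto continuous_const).closure_subset_iff.2
      (fun A hA => tendsto_lie_spaceAverage_of_isLocal hμ hA hC) (dense_isLocal A)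
  have hequi := (LipschitzWith.uniformEquicontinuous _ _ (hlip_right A)).equicontinuous
  exact (hequi.isClosed_setOfPred_tendsto continuous_const).closure_subset_iff.2
    (fun C hC => hlocal hC A) (dense_isLocal C)

/-! ### The mean ergodic theorem -/

theorem exists_mem_closure_norm_sub_sq_le {W : Type*} [NormedAddCommGroup W]
    [InnerProductSpace ℝ W] [CompleteSpace W] {K : Set W} (hne : K.Nonempty) (hK : Convex ℝ K) :
    ∃ w ∈ closure K, ∀ v ∈ K, ‖v - w‖ ^ 2 ≤ ‖v‖ ^ 2 - ‖w‖ ^ 2 := by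
  obtain ⟨w, hw, hmin⟩ := exists_norm_eq_iInf_of_complete_convex hne.closure
    isClosed_closure.isComplete hK.closure 0
  rw [norm_eq_iInf_iff_real_inner_le_zero hK.closure hw] at hmin
  refine ⟨w, hw, fun v hv => ?_⟩
  have hinner := hmin v (subset_closure hv)
  have hsplit := norm_add_sq_real (v - w) w
  rw [sub_add_cancel] at hsplit
  rw [zero_sub, inner_neg_left, real_inner_comm] at hinner
  linarith

/-- The convex hull of the translates of `B`. -/
noncomputable def translationHull (B : SpinAlgebra d μ) : Set (SpinAlgebra d μ) :=
  convexHull ℝ (Set.range fun z => translation z B)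

theorem tendsto_spaceAverage_sub_of_mem_translationHull {B C : SpinAlgebra d μ}
    (hC : C ∈ translationHull B) :
    Tendsto (fun Λ => spaceAverage Λ C - spaceAverage Λ B) (vanHove μ) (𝓝 0) := by
  refine convexHull_min (t := {C | Tendsto (fun Λ => spaceAverage Λ C - spaceAverage Λ B)
    (vanHove μ) (𝓝 0)}) ?_ ?_ hC
  · rintro _ ⟨z, rfl⟩
    exact tendsto_spaceAverage_translation_sub z B
  · intro C hC C' hC' a b _ _ hab
    have hlim := (hC.const_smul (a : ℂ)).add (hC'.const_smul (b : ℂ))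
    simp only [smul_zero, add_zero] at hlim
    refine hlim.congr fun Λ => ?_
    have hab' : (a : ℂ) + b = 1 := by exact_mod_cast hab
    rw [← Complex.coe_smul, ← Complex.coe_smul, spaceAverage_add, spaceAverage_smul,
      spaceAverage_smul]
    linear_combination (norm := module) hab' • (-spaceAverage Λ B)

theorem translation_mem_translationHull {B C : SpinAlgebra d μ} (hC : C ∈ translationHull B)
    (x : Site μ) : translation x C ∈ translationHull B := by
  have hlin : IsLinearMap ℝ (translation x : SpinAlgebra d μ → SpinAlgebra d μ) :=
    ⟨map_add _, fun r A => by rw [← Complex.coe_smul, map_smul, Complex.coe_smul]⟩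
  refine convexHull_min ?_ ((convex_convexHull ℝ _).is_linear_preimage hlin) hC
  rintro _ ⟨z, rfl⟩
  rw [Set.mem_preimage, translation_translation]
  exact subset_convexHull ℝ _ (Set.mem_range_self _)

theorem spaceAverage_mem_translationHull {B C : SpinAlgebra d μ} (hC : C ∈ translationHull B)
    {Λ : Finset (Site μ)} (hΛ : Λ.Nonempty) : spaceAverage Λ C ∈ translationHull B := by
  have hmem := (convex_convexHull ℝ _).sum_mem (t := Λ) (w := fun _ => (Λ.card : ℝ)⁻¹)
    (fun _ _ => by positivity) (by simp [hΛ.ne_empty])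
    fun x _ => translation_mem_translationHull hC x
  rw [← Finset.smul_sum, ← Complex.coe_smul] at hmem
  simpa [spaceAverage, translationHull] using hmem

/-- Averages of points of the hull whose image has almost minimal norm stay close to the point of
minimal norm, and they are averages of `B` up to a boundary term. -/
theorem exists_tendsto_map_spaceAverage {W : Type*} [NormedAddCommGroup W]
    [InnerProductSpace ℂ W] [CompleteSpace W] (V : SpinAlgebra d μ →L[ℂ] W)
    (hV : ∀ z A, ‖V (translation z A)‖ ≤ ‖V A‖) (B : SpinAlgebra d μ) :
    ∃ w, Tendsto (fun Λ => V (spaceAverage Λ B)) (vanHove μ) (𝓝 w) := by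
  let _ : InnerProductSpace ℝ W := InnerProductSpace.rclikeToReal ℂ W
  obtain ⟨w, hw, hmin⟩ := exists_mem_closure_norm_sub_sq_le
    (K := V '' translationHull B) ((Set.range_nonempty _).convexHull.image V)
    ((convex_convexHull ℝ _).is_linear_image
      ((V.restrictScalars ℝ).toLinearMap.isLinear))
  refine ⟨w, Metric.tendsto_nhds.2 fun ε hε => ?_⟩
  have hnear : ∀ᶠ v in 𝓝 w, ‖v‖ ^ 2 < ‖w‖ ^ 2 + (ε / 2) ^ 2 :=
    (continuous_norm.pow 2).continuousAt.eventually_lt_const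
      (lt_add_of_pos_right _ (by positivity))
  obtain ⟨_, hC, C, hCB, rfl⟩ := mem_closure_iff_nhds.1 hw _ hnear
  have haverage (Λ : Finset (Site μ)) (hΛ : Λ.Nonempty) :
      ‖V (spaceAverage Λ C) - w‖ < ε / 2 := by
    have hle : ‖V (spaceAverage Λ C)‖ ≤ ‖V C‖ := by
      rw [spaceAverage, map_smul, map_sum]
      exact norm_inv_card_smul_sum_le Λ _ (norm_nonneg _) fun x _ => hV x C
    have hsq := hmin _ ⟨_, spaceAverage_mem_translationHull hCB hΛ, rfl⟩
    refine lt_of_pow_lt_pow_left₀ 2 (by positivity) ?_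
    have := pow_le_pow_left₀ (norm_nonneg _) hle 2
    change ‖V C‖ ^ 2 < _ at hC
    linarith
  have hlim := (V.continuous.tendsto 0).comp (tendsto_spaceAverage_sub_of_mem_translationHull hCB)
  rw [map_zero, NormedAddGroup.tendsto_nhds_zero] at hlim
  filter_upwards [hlim (ε / 2) (by positivity), vanHove_le_atTop (eventually_ge_atTop {0})]
    with Λ hΛ h0
  rw [Function.comp_apply, map_sub, ← dist_eq_norm, dist_comm] at hΛ
  have := haverage Λ ⟨0, h0 (by simp)⟩
  rw [← dist_eq_norm] at this
  linarith [dist_triangle (V (spaceAverage Λ B)) (V (spaceAverage Λ C)) w]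

/-! ### Densities in the GNS representation of a homogeneous state -/

theorem exists_forall_tendsto_of_dense {𝕜 F G ι : Type*} [NontriviallyNormedField 𝕜]
    [NormedAddCommGroup F] [NormedSpace 𝕜 F] [NormedAddCommGroup G] [NormedSpace 𝕜 G]
    [CompleteSpace G] {l : Filter ι} [l.NeBot] {T : ι → F →L[𝕜] G} {K : ℝ} (hK : ∀ i, ‖T i‖ ≤ K)
    {s : Set F} (hs : Dense s) (hT : ∀ v ∈ s, ∃ w, Tendsto (fun i => T i v) l (𝓝 w)) :
    ∃ a : F →L[𝕜] G, ∀ v, Tendsto (fun i => T i v) l (𝓝 (a v)) := by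
  have hequi : Equicontinuous fun (p : ι × ι) v => T p.1 v - T p.2 v := by
    refine (LipschitzWith.uniformEquicontinuous _ (K + K).toNNReal fun p => ?_).equicontinuous
    exact (T p.1 - T p.2).lipschitz.weaken
      (NNReal.le_toNNReal_of_coe_le (norm_sub_le_of_le (hK p.1) (hK p.2)))
  have hcauchy : ∀ v, Cauchy (map (fun i => T i v) l) := fun v =>
    (IsUniformAddGroup.cauchy_map_iff_tendsto _ _).2 ⟨‹_›, (hequi.isClosed_setOfPred_tendsto
      continuous_const).closure_subset_iff.2 (fun u hu =>
        ((IsUniformAddGroup.cauchy_map_iff_tendsto _ _).1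
          (cauchy_map_iff_exists_tendsto.2 (hT u hu))).2) (hs v)⟩
  choose a ha using fun v => cauchy_map_iff_exists_tendsto.1 (hcauchy v)
  refine ⟨.ofTendstoOfBoundedRange a T (tendsto_pi_nhds.2 ha) ?_, ha⟩
  exact isBounded_iff_forall_norm_le.2 ⟨K, Set.forall_mem_range.2 hK⟩

theorem tendsto_apply_of_bounded {𝕜 F G ι : Type*} [NontriviallyNormedField 𝕜]
    [NormedAddCommGroup F] [NormedSpace 𝕜 F] [NormedAddCommGroup G] [NormedSpace 𝕜 G]
    {l : Filter ι} {T : ι → F →L[𝕜] G} {K : ℝ} (hK : ∀ i, ‖T i‖ ≤ K) {a : F →L[𝕜] G}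
    (hT : ∀ v, Tendsto (fun i => T i v) l (𝓝 (a v))) {v : ι → F} {w : F}
    (hv : Tendsto v l (𝓝 w)) : Tendsto (fun i => T i (v i)) l (𝓝 (a w)) := by
  have hdiff : Tendsto (fun i => T i (v i - w)) l (𝓝 0) := by
    refine squeeze_zero_norm (fun i => (T i).le_of_opNorm_le (hK i) _) ?_
    simpa using (tendsto_iff_norm_sub_tendsto_zero.1 hv).const_mul K
  simpa using hdiff.add (hT w)

section GNS

variable {E : Type*} [NormedAddCommGroup E] [InnerProductSpace ℂ E] [CompleteSpace E]
  {φ : SpinAlgebra d μ →ₗ[ℂ] ℂ} {π : SpinAlgebra d μ →⋆ₐ[ℂ] (E →L[ℂ] E)} {Ω : E}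

theorem norm_starAlgHom_apply_le (π : SpinAlgebra d μ →⋆ₐ[ℂ] (E →L[ℂ] E)) (A : SpinAlgebra d μ)
    (v : E) : ‖π A v‖ ≤ ‖A‖ * ‖v‖ :=
  (π A).le_of_opNorm_le (NonUnitalStarAlgHom.norm_apply_le π A) v

theorem norm_map_spaceAverage_le (π : SpinAlgebra d μ →⋆ₐ[ℂ] (E →L[ℂ] E)) (Λ : Finset (Site μ))
    (A : SpinAlgebra d μ) : ‖π (spaceAverage Λ A)‖ ≤ ‖A‖ :=
  (NonUnitalStarAlgHom.norm_apply_le π _).trans (norm_spaceAverage_le Λ A)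

theorem IsGNSTriple.norm_sq (hGNS : IsGNSTriple φ π Ω) (A : SpinAlgebra d μ) :
    ‖π A Ω‖ ^ 2 = (φ (star A * A)).re := by
  rw [hGNS.vector_state, map_mul, map_star, mul_apply_eq_comp,
    ContinuousLinearMap.star_eq_adjoint, ContinuousLinearMap.adjoint_inner_right,
    inner_self_eq_norm_sq_to_K]
  norm_cast

theorem IsGNSTriple.norm_translation_eq_of_quotient_eq (hGNS : IsGNSTriple φ π Ω)
    {Δ : AddSubgroup (Site μ)} (hΔ : ∀ x ∈ Δ, ∀ A, φ (translation x A) = φ A)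
    (A : SpinAlgebra d μ) {x y : Site μ} (hxy : (x : Site μ ⧸ Δ) = y) :
    ‖π (translation x A) Ω‖ = ‖π (translation y A) Ω‖ := by
  have hy : translation y A = translation (-x + y) (translation x A) := by
    rw [translation_translation, add_neg_cancel_left]
  have hinv := hΔ _ (QuotientAddGroup.eq.1 hxy) (star (translation x A) * translation x A)
  rw [map_mul, map_star, ← hy] at hinv
  rw [← sq_eq_sq₀ (norm_nonneg _) (norm_nonneg _), hGNS.norm_sq, hGNS.norm_sq, hinv]

/-- The map `A ↦ (π(τ_c A) Ω)_c`, where `c` runs through representatives of the cosets of `Δ`. Its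
norm is translation invariant if the vector state of `Ω` is invariant under `Δ`. -/
noncomputable def cosetOrbitMap (π : SpinAlgebra d μ →⋆ₐ[ℂ] (E →L[ℂ] E)) (Ω : E)
    (Δ : AddSubgroup (Site μ)) [Fintype (Site μ ⧸ Δ)] :
    SpinAlgebra d μ →L[ℂ] PiLp 2 fun _ : Site μ ⧸ Δ => E :=
  (PiLp.continuousLinearEquiv 2 ℂ fun _ : Site μ ⧸ Δ => E).symm.toContinuousLinearMap ∘L
    ContinuousLinearMap.pi fun c => LinearMap.mkContinuous
      { toFun := fun A => π (translation c.out A) Ω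
        map_add' := fun A B => by simp
        map_smul' := fun a A => by simp } ‖Ω‖ fun A => by
          rw [mul_comm]
          exact (norm_starAlgHom_apply_le π _ Ω).trans (by gcongr; exact norm_translation_le _ A)

theorem cosetOrbitMap_apply (Δ : AddSubgroup (Site μ)) [Fintype (Site μ ⧸ Δ)]
    (A : SpinAlgebra d μ) (c : Site μ ⧸ Δ) :
    cosetOrbitMap π Ω Δ A c = π (translation c.out A) Ω := rfl

theorem IsGNSTriple.norm_cosetOrbitMap_translation (hGNS : IsGNSTriple φ π Ω)
    {Δ : AddSubgroup (Site μ)} [Fintype (Site μ ⧸ Δ)]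
    (hΔ : ∀ x ∈ Δ, ∀ A, φ (translation x A) = φ A) (z : Site μ) (A : SpinAlgebra d μ) :
    ‖cosetOrbitMap π Ω Δ (translation z A)‖ = ‖cosetOrbitMap π Ω Δ A‖ := by
  rw [PiLp.norm_eq_of_L2, PiLp.norm_eq_of_L2]
  congr 1
  refine Fintype.sum_equiv (Equiv.addLeft (z : Site μ ⧸ Δ)) _ _ fun c => ?_
  have hcoset : ((z + c.out : Site μ) : Site μ ⧸ Δ) = ((z : Site μ ⧸ Δ) + c).out := by simp
  rw [cosetOrbitMap_apply, cosetOrbitMap_apply, translation_translation,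
    hGNS.norm_translation_eq_of_quotient_eq hΔ A hcoset]
  rfl

theorem IsGNSTriple.exists_tendsto_spaceAverage_vector (hGNS : IsGNSTriple φ π Ω)
    (hhom : IsHomogeneous φ) (A : SpinAlgebra d μ) :
    ∃ w, Tendsto (fun Λ => π (spaceAverage Λ A) Ω) (vanHove μ) (𝓝 w) := by
  obtain ⟨Δ, _, hΔ⟩ := hhom
  let _ : Fintype (Site μ ⧸ Δ) := AddSubgroup.fintypeQuotientOfFiniteIndex
  obtain ⟨w, hw⟩ := exists_tendsto_map_spaceAverage (cosetOrbitMap π Ω Δ)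
    (fun z A => (hGNS.norm_cosetOrbitMap_translation hΔ z A).le) A
  let c : Site μ ⧸ Δ := 0
  have hc : Tendsto (fun Λ => π (spaceAverage Λ (translation c.out A)) Ω) (vanHove μ)
      (𝓝 (w c)) := by
    simpa only [Function.comp_def, cosetOrbitMap_apply, translation_spaceAverage] using
      ((PiLp.continuous_apply 2 (fun _ : Site μ ⧸ Δ => E) c).tendsto w).comp hw
  have hboundary : Tendsto (fun Λ => π (spaceAverage Λ (translation c.out A) - spaceAverage Λ A) Ω)
      (vanHove μ) (𝓝 0) := by
    refine squeeze_zero_norm (fun Λ => norm_starAlgHom_apply_le π _ Ω) ?_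
    simpa using (tendsto_spaceAverage_translation_sub c.out A).norm.mul_const ‖Ω‖
  exact ⟨w c - 0, (hc.sub hboundary).congr fun Λ => by simp⟩

theorem IsGNSTriple.exists_forall_tendsto_spaceAverage (hμ : 1 ≤ μ) (hGNS : IsGNSTriple φ π Ω)
    (hhom : IsHomogeneous φ) (A : SpinAlgebra d μ) :
    ∃ a : E →L[ℂ] E, ∀ v, Tendsto (fun Λ => π (spaceAverage Λ A) v) (vanHove μ) (𝓝 (a v)) := by
  obtain ⟨w, hw⟩ := hGNS.exists_tendsto_spaceAverage_vector hhom A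
  refine exists_forall_tendsto_of_dense (fun Λ => norm_map_spaceAverage_le π Λ A) hGNS.cyclic ?_
  rintro _ ⟨C, rfl⟩
  have hcomm : Tendsto (fun Λ => π ⁅spaceAverage Λ A, C⁆ Ω) (vanHove μ) (𝓝 0) := by
    refine squeeze_zero_norm (fun Λ => norm_starAlgHom_apply_le π _ Ω) ?_
    simpa using (tendsto_lie_spaceAverage hμ A C).norm.mul_const ‖Ω‖
  exact ⟨π C w + 0, ((((π C).continuous.tendsto w).comp hw).add hcomm).congr fun Λ => by
    simp [Ring.lie_def]⟩

theorem isDensity_iff_of_tendsto {A : SpinAlgebra d μ} {a : E →L[ℂ] E}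
    (ha : ∀ v, Tendsto (fun Λ => π (spaceAverage Λ A) v) (vanHove μ) (𝓝 (a v)))
    {b : E →L[ℂ] E} : IsDensity π A b ↔ b = a := by
  have hlim : Tendsto (fun Λ => (ContinuousLinearMapWOT.ofCLM (π (spaceAverage Λ A)) : E →WOT[ℂ] E))
      (vanHove μ) (𝓝 (ContinuousLinearMapWOT.ofCLM a)) :=
    ContinuousLinearMapWOT.tendsto_iff_forall_inner_apply_tendsto.2 fun v w =>
      tendsto_const_nhds.inner (ha v)
  constructor
  · intro hb
    exact ContinuousLinearMapWOT.ofCLM_injective (eq_of_nhds_neBot (ClusterPt.mono hb hlim))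
  · rintro rfl
    exact hlim.mapClusterPt

theorem temporalCorrelations_eq_singleton {α : ℝ → (SpinAlgebra d μ ≃⋆ₐ[ℂ] SpinAlgebra d μ)}
    {A B : SpinAlgebra d μ} {t : ℝ} {a b : E →L[ℂ] E}
    (ha : ∀ v, Tendsto (fun Λ => π (spaceAverage Λ (α t A)) v) (vanHove μ) (𝓝 (a v)))
    (hb : ∀ v, Tendsto (fun Λ => π (spaceAverage Λ B) v) (vanHove μ) (𝓝 (b v))) :
    temporalCorrelations π Ω α A B t = {inner ℂ Ω (a (b Ω))} := by
  ext z
  simp [temporalCorrelations, isDensity_iff_of_tendsto ha, isDensity_iff_of_tendsto hb]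

end GNS

/-! ### The commutator series of the local dynamics -/

section CommutatorSeries

variable {𝕜 𝔸 : Type*} [RCLike 𝕜] [NormedRing 𝔸] [NormedAlgebra 𝕜 𝔸] [CompleteSpace 𝔸]

theorem exp_apply_eq_of_pow_apply {T f : 𝔸 →L[𝕜] 𝔸} {a b : 𝔸} (hT : ∀ n, (T ^ n) b = f (a ^ n)) :
    NormedSpace.exp T b = f (NormedSpace.exp a) := by
  refine ((NormedSpace.exp_series_hasSum_exp' (𝕂 := 𝕜) T).mapL (.apply 𝕜 𝔸 b)).unique ?_
  refine ((NormedSpace.exp_series_hasSum_exp' (𝕂 := 𝕜) a).mapL f).congr_fun fun n => ?_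
  simp [hT]

theorem hasSum_ad_pow (a b : 𝔸) :
    HasSum (fun n : ℕ => (n.factorial : 𝕜)⁻¹ • (LieAlgebra.ad 𝕜 𝔸 a ^ n) b)
      (NormedSpace.exp a * b * NormedSpace.exp (-a)) := by
  let +nondep : NormedAlgebra ℚ (𝔸 →L[𝕜] 𝔸) := .restrictScalars ℚ 𝕜 _
  let L : 𝔸 →L[𝕜] 𝔸 := .mul 𝕜 𝔸 a
  let R : 𝔸 →L[𝕜] 𝔸 := (ContinuousLinearMap.mul 𝕜 𝔸).flip (-a)
  have hcomm : Commute L R := ContinuousLinearMap.ext fun c => by simp [L, R, mul_assoc]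
  have hL (c : 𝔸) : NormedSpace.exp L c = NormedSpace.exp a * c := by
    refine exp_apply_eq_of_pow_apply (f := (ContinuousLinearMap.mul 𝕜 𝔸).flip c) fun n => ?_
    induction n with
    | zero => simp
    | succ n ih => simp [pow_succ', ih, L, mul_assoc]
  have hR (c : 𝔸) : NormedSpace.exp R c = c * NormedSpace.exp (-a) := by
    refine exp_apply_eq_of_pow_apply (f := ContinuousLinearMap.mul 𝕜 𝔸 c) fun n => ?_
    induction n with
    | zero => simp
    | succ n ih =>
      rw [pow_succ', mul_apply_eq_comp, ih, pow_succ]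
      simp [R, mul_assoc]
  have had (n : ℕ) : (LieAlgebra.ad 𝕜 𝔸 a ^ n) b = ((L + R) ^ n) b := by
    induction n with
    | zero => rfl
    | succ n ih =>
      rw [pow_succ', pow_succ', Module.End.mul_apply, ih]
      simp [L, R, Ring.lie_def, sub_eq_add_neg]
  have hexp : NormedSpace.exp a * b * NormedSpace.exp (-a) = NormedSpace.exp (L + R) b := by
    rw [NormedSpace.exp_add_of_commute hcomm, mul_assoc, ← hR, ← hL]
    rfl
  rw [hexp]
  refine ((NormedSpace.exp_series_hasSum_exp' (𝕂 := 𝕜) (L + R)).mapL (.apply 𝕜 𝔸 b)).congr_fun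
    fun n => ?_
  simp [had]

end CommutatorSeries

theorem hasSum_localEvolution (h : Site μ → SpinAlgebra d μ) (Λ : Finset (Site μ)) (t : ℝ)
    (A : SpinAlgebra d μ) :
    HasSum (fun n : ℕ => ((n.factorial : ℂ)⁻¹ * (Complex.I * t) ^ n) •
      (LieAlgebra.ad ℂ _ (localHamiltonian h Λ) ^ n) A) (localEvolution h Λ t A) := by
  rw [localEvolution, neg_smul]
  refine (hasSum_ad_pow (𝕜 := ℂ) _ A).congr_fun fun n => ?_
  rw [map_smul, smul_pow, LinearMap.smul_apply, smul_smul]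

section Interaction

variable {h : Site μ → SpinAlgebra d μ} {R : ℕ}

theorem lie_localHamiltonian_eq_sum [DecidableEq (Site μ)]
    (hR : ∀ y, h y ∈ localSubalgebra d (box y R)) {S : Set (Site μ)} {A : SpinAlgebra d μ}
    (hA : A ∈ localSubalgebra d S) (Λ : Finset (Site μ)) {U : Finset (Site μ)}
    (hU : ∀ x ∈ S, box x R ⊆ U) :
    ⁅localHamiltonian h Λ, A⁆ = ∑ y ∈ Λ ∩ U, ⁅h y, A⁆ := by
  rw [localHamiltonian, sum_lie]
  refine (Finset.sum_subset Finset.inter_subset_left fun y hy hyU => ?_).symm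
  refine (commute_of_mem_localSubalgebra (Set.disjoint_left.2 fun z hz hzS => ?_)
    (hR y) hA).lie_eq
  exact hyU (Finset.mem_inter.2 ⟨hy, hU z hzS (mem_box_comm.1 hz)⟩)

theorem lie_mem_localSubalgebra {S T : Set (Site μ)} {A B : SpinAlgebra d μ}
    (hA : A ∈ localSubalgebra d S) (hB : B ∈ localSubalgebra d T) :
    ⁅A, B⁆ ∈ localSubalgebra d (S ∪ T) := by
  have hA' := localSubalgebra_mono (T := S ∪ T) Set.subset_union_left hA
  have hB' := localSubalgebra_mono (S := T) (T := S ∪ T) Set.subset_union_right hB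
  rw [Ring.lie_def]
  exact sub_mem (mul_mem hA' hB') (mul_mem hB' hA')

variable {N : ℝ}

/-- Commuting with `H_Λ` enlarges the support of `A` by at most `(2R+1)^μ` sites, and only
`(2R+1)^μ |supp A|` of the `h_y` contribute. -/
theorem norm_ad_localHamiltonian_pow_le_ascFactorial
    (hR : ∀ y, h y ∈ localSubalgebra d (box y R)) (hN : ∀ y, ‖h y‖ ≤ N) (Λ : Finset (Site μ))
    (n s : ℕ) {S : Finset (Site μ)} {A : SpinAlgebra d μ}
    (hS : S.card ≤ (2 * R + 1) ^ μ * (s + 1)) (hA : A ∈ localSubalgebra d (S : Set (Site μ))) :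
    ‖(LieAlgebra.ad ℂ _ (localHamiltonian h Λ) ^ n) A‖ ≤
      (2 * N * ((2 * R + 1) ^ μ) ^ 2) ^ n * (s + 1).ascFactorial n * ‖A‖ := by
  classical
  have hN0 : 0 ≤ N := (norm_nonneg _).trans (hN 0)
  induction n generalizing s S A with
  | zero => simp
  | succ n ih =>
    let U : Finset (Site μ) := S.biUnion fun x => finBox x R
    have hU : ∀ x ∈ (S : Set (Site μ)), box x R ⊆ U := fun x hx => by
      rw [← coe_finBox]
      exact Finset.coe_subset.2 (Finset.subset_biUnion_of_mem (finBox · R) hx)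
    have hcard : (Λ ∩ U).card ≤ (2 * R + 1) ^ μ * ((2 * R + 1) ^ μ * (s + 1)) :=
      (Finset.card_le_card Finset.inter_subset_right).trans <|
        (Finset.card_biUnion_le_card_mul S _ _ fun x _ => (card_finBox x R).le).trans <| by
          rw [mul_comm]; gcongr
    have hterm (y : Site μ) : ‖(LieAlgebra.ad ℂ _ (localHamiltonian h Λ) ^ n) ⁅h y, A⁆‖ ≤
        (2 * N * ((2 * R + 1) ^ μ) ^ 2) ^ n * (s + 2).ascFactorial n * (2 * N * ‖A‖) := by
      refine (ih (s + 1) (S := finBox y R ∪ S) ?_ ?_).trans ?_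
      · refine (Finset.card_union_le _ _).trans ?_
        rw [card_finBox]
        linarith
      · rw [Finset.coe_union, coe_finBox]
        exact lie_mem_localSubalgebra (hR y) hA
      · gcongr
        exact (norm_lie_le _ _).trans (by gcongr; exact hN y)
    have hasc : (s + 1).ascFactorial (n + 1) = (s + 1) * (s + 2).ascFactorial n := by
      rw [Nat.ascFactorial_succ, ← Nat.succ_ascFactorial]
    rw [pow_succ, Module.End.mul_apply, LieAlgebra.ad_apply, lie_localHamiltonian_eq_sum hR hA Λ hU,
      map_sum]
    refine (norm_sum_le_of_le _ fun y _ => hterm y).trans ?_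
    rw [Finset.sum_const, nsmul_eq_mul, hasc]
    refine (mul_le_mul_of_nonneg_right (Nat.cast_le.2 hcard) (by positivity)).trans_eq ?_
    push_cast
    ring

theorem norm_ad_localHamiltonian_pow_le (hR : ∀ y, h y ∈ localSubalgebra d (box y R))
    (hN : ∀ y, ‖h y‖ ≤ N) (Λ : Finset (Site μ)) (n : ℕ) {S : Finset (Site μ)}
    {A : SpinAlgebra d μ} (hA : A ∈ localSubalgebra d (S : Set (Site μ))) :
    ‖(LieAlgebra.ad ℂ _ (localHamiltonian h Λ) ^ n) A‖ ≤
      n.factorial * (4 * N * ((2 * R + 1) ^ μ) ^ 2) ^ n * (2 ^ S.card * ‖A‖) := by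
  have hN0 : 0 ≤ N := (norm_nonneg _).trans (hN 0)
  have hcard : S.card ≤ (2 * R + 1) ^ μ * (S.card + 1) := by
    nlinarith [Nat.one_le_pow μ (2 * R + 1) (by lia)]
  have hasc : (S.card + 1).ascFactorial n ≤ n.factorial * 2 ^ (S.card + n) := by
    rw [Nat.ascFactorial_eq_factorial_mul_choose]
    gcongr
    exact Nat.choose_le_two_pow _ _
  calc ‖(LieAlgebra.ad ℂ _ (localHamiltonian h Λ) ^ n) A‖
      ≤ (2 * N * ((2 * R + 1) ^ μ) ^ 2) ^ n * (S.card + 1).ascFactorial n * ‖A‖ :=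
        norm_ad_localHamiltonian_pow_le_ascFactorial hR hN Λ n S.card hcard hA
    _ ≤ (2 * N * ((2 * R + 1) ^ μ) ^ 2) ^ n * (n.factorial * 2 ^ (S.card + n) : ℕ) * ‖A‖ := by
        gcongr
    _ = _ := by
        rw [show 4 * N * ((2 * (R : ℝ) + 1) ^ μ) ^ 2 = 2 * (2 * N * ((2 * R + 1) ^ μ) ^ 2) by ring,
          mul_pow (2 : ℝ)]
        push_cast
        ring

/-- The factorial in the commutator bound cancels that of the exponential series, so the series
converges geometrically, uniformly in `Λ`, for small `|t|`. -/
theorem norm_commutatorSeries_term_le (hR : ∀ y, h y ∈ localSubalgebra d (box y R))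
    (hN : ∀ y, ‖h y‖ ≤ N) {t : ℝ} (ht : |t| * (4 * N * ((2 * R + 1) ^ μ) ^ 2) ≤ 1 / 2)
    (Λ : Finset (Site μ)) (n : ℕ) {S : Finset (Site μ)} {A : SpinAlgebra d μ}
    (hA : A ∈ localSubalgebra d (S : Set (Site μ))) :
    ‖((n.factorial : ℂ)⁻¹ * (Complex.I * t) ^ n) •
      (LieAlgebra.ad ℂ _ (localHamiltonian h Λ) ^ n) A‖ ≤ 2 ^ S.card * ‖A‖ * (1 / 2) ^ n := by
  have hN0 : 0 ≤ N := (norm_nonneg _).trans (hN 0)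
  rw [norm_smul, norm_mul, norm_inv, norm_pow, norm_mul, Complex.norm_I, Complex.norm_natCast,
    Complex.norm_real, Real.norm_eq_abs, one_mul]
  calc (n.factorial : ℝ)⁻¹ * |t| ^ n * ‖(LieAlgebra.ad ℂ _ (localHamiltonian h Λ) ^ n) A‖
      ≤ (n.factorial : ℝ)⁻¹ * |t| ^ n *
          (n.factorial * (4 * N * ((2 * R + 1) ^ μ) ^ 2) ^ n * (2 ^ S.card * ‖A‖)) := by
        gcongr
        exact norm_ad_localHamiltonian_pow_le hR hN Λ n hA
    _ = 2 ^ S.card * ‖A‖ * (|t| * (4 * N * ((2 * R + 1) ^ μ) ^ 2)) ^ n := by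
        rw [mul_pow |t|]
        field_simp
    _ ≤ 2 ^ S.card * ‖A‖ * (1 / 2) ^ n := by gcongr

end Interaction

/-! ### Quasi-locality of the local dynamics, uniform in the volume -/

section LocalEvolution

variable (h : Site μ → SpinAlgebra d μ) (Λ : Finset (Site μ))

theorem localEvolution_zero (A : SpinAlgebra d μ) : localEvolution h Λ 0 A = A := by
  simp [localEvolution]

theorem localEvolution_add (s t : ℝ) (A : SpinAlgebra d μ) :
    localEvolution h Λ (s + t) A = localEvolution h Λ s (localEvolution h Λ t A) := by
  let +nondep : NormedAlgebra ℚ (SpinAlgebra d μ) := .restrictScalars ℚ ℂ _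
  have hcomm (a b : ℂ) : Commute (a • localHamiltonian h Λ) (b • localHamiltonian h Λ) :=
    ((Commute.refl _).smul_left a).smul_right b
  simp only [localEvolution, Complex.ofReal_add, mul_add]
  rw [neg_add_rev, add_smul, add_smul, NormedSpace.exp_add_of_commute (hcomm _ _),
    NormedSpace.exp_add_of_commute (hcomm _ _)]
  simp only [mul_assoc]

theorem localEvolution_sub (t : ℝ) (A B : SpinAlgebra d μ) :
    localEvolution h Λ t (A - B) = localEvolution h Λ t A - localEvolution h Λ t B := by
  simp [localEvolution, mul_sub, sub_mul]

theorem localEvolution_spaceAverage (Λ' : Finset (Site μ)) (t : ℝ) (A : SpinAlgebra d μ) :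
    localEvolution h Λ t (spaceAverage Λ' A) =
      (Λ'.card : ℂ)⁻¹ • ∑ x ∈ Λ', localEvolution h Λ t (translation x A) := by
  simp [localEvolution, spaceAverage, Finset.mul_sum, Finset.sum_mul]

variable {h} in
theorem norm_localEvolution_le (hsa : ∀ x, IsSelfAdjoint (h x)) (t : ℝ) (A : SpinAlgebra d μ) :
    ‖localEvolution h Λ t A‖ ≤ ‖A‖ := by
  have hH : IsSelfAdjoint (localHamiltonian h Λ) := isSelfAdjoint_sum Λ fun x _ => hsa x
  have hunitary (s : ℝ) : NormedSpace.exp ((Complex.I * (s : ℂ)) • localHamiltonian h Λ) ∈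
      unitary (SpinAlgebra d μ) := by
    have hs : IsSelfAdjoint ((s : ℂ) • localHamiltonian h Λ) :=
      IsSelfAdjoint.smul (Complex.conj_ofReal s) hH
    simpa [mul_smul] using (selfAdjoint.expUnitary ⟨_, hs⟩).2
  have hneg := hunitary (-t)
  rw [Complex.ofReal_neg, mul_neg] at hneg
  rw [localEvolution, CStarRing.norm_mul_mem_unitary _ hneg,
    CStarRing.norm_mem_unitary_mul _ (hunitary t)]

end LocalEvolution

/-- The uniformly bounded families `(A_x)` for which `A_x` is localized in a box around `x` whose
radius does not depend on `x`. -/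
def uniformlyLocal (d μ : ℕ) : Submodule ℂ (Site μ → SpinAlgebra d μ) where
  carrier := {A | ∃ (r : ℕ) (M : ℝ), ∀ x, A x ∈ localSubalgebra d (box x r) ∧ ‖A x‖ ≤ M}
  zero_mem' := ⟨0, 0, fun _ => ⟨zero_mem _, norm_zero.le⟩⟩
  add_mem' := by
    rintro A B ⟨r, M, hA⟩ ⟨r', M', hB⟩
    exact ⟨max r r', M + M', fun x =>
      ⟨add_mem (localSubalgebra_mono (box_mono x (le_max_left r r')) (hA x).1)
        (localSubalgebra_mono (box_mono x (le_max_right r r')) (hB x).1),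
        norm_add_le_of_le (hA x).2 (hB x).2⟩⟩
  smul_mem' := by
    rintro c A ⟨r, M, hA⟩
    refine ⟨r, ‖c‖ * M, fun x => ⟨SMulMemClass.smul_mem c (hA x).1, ?_⟩⟩
    exact (norm_smul_le c (A x)).trans (by gcongr; exact (hA x).2)

theorem translation_mem_uniformlyLocal {A : SpinAlgebra d μ} (hA : IsLocal A) :
    (fun x => translation x A) ∈ uniformlyLocal d μ := by
  obtain ⟨S, hS⟩ := hA
  obtain ⟨m, hm⟩ := exists_subset_box S
  refine ⟨m, ‖A‖, fun x => ⟨localSubalgebra_mono ?_ (translation_mem_localSubalgebra hS x),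
    norm_translation_le x A⟩⟩
  rintro _ ⟨y, hy, rfl⟩ k
  simpa using hm hy k

/-- A family `(F_{Λ,x})` is uniformly quasi-local if, for `x` deep inside `Λ`, it is approximated
in norm by uniformly local families that do not depend on `Λ`. -/
def IsUniformlyQuasiLocal (F : Finset (Site μ) × Site μ → SpinAlgebra d μ) : Prop :=
  ∀ ε > 0, ∃ B ∈ uniformlyLocal d μ, ∀ᶠ p in interiorFilter μ, ‖F p - B p.2‖ ≤ ε

namespace IsUniformlyQuasiLocal

variable {F : Finset (Site μ) × Site μ → SpinAlgebra d μ}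

theorem of_approx (hF : ∀ ε > 0, ∃ G, IsUniformlyQuasiLocal G ∧
    ∀ᶠ p in interiorFilter μ, ‖F p - G p‖ ≤ ε) : IsUniformlyQuasiLocal F := by
  intro ε hε
  obtain ⟨G, hG, hFG⟩ := hF (ε / 2) (half_pos hε)
  obtain ⟨B, hB, hGB⟩ := hG (ε / 2) (half_pos hε)
  refine ⟨B, hB, ?_⟩
  filter_upwards [hFG, hGB] with p hp hp'
  exact (norm_sub_le_norm_sub_add_norm_sub _ _ _).trans (by linarith)

theorem translation (A : SpinAlgebra d μ) :
    IsUniformlyQuasiLocal fun p : Finset (Site μ) × Site μ => translation p.2 A := by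
  intro ε hε
  obtain ⟨B, hB, hAB⟩ := Metric.mem_closure_iff.1 (dense_isLocal A) ε hε
  refine ⟨_, translation_mem_uniformlyLocal hB, .of_forall fun p => ?_⟩
  rw [← map_sub]
  exact (norm_translation_le p.2 _).trans (dist_eq_norm A B ▸ hAB.le)

/-- The approximants do not depend on `Λ`, so the limit as `Λ ↑ Γ` at a fixed site is close to `F`
already for every `Λ` that surrounds the site deeply. -/
theorem tendsto_sub_of_tendsto (hF : IsUniformlyQuasiLocal F) {G : Site μ → SpinAlgebra d μ}
    (hG : ∀ x, Tendsto (fun Λ => F (Λ, x)) atTop (𝓝 (G x))) :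
    Tendsto (fun p => F p - G p.2) (interiorFilter μ) (𝓝 0) := by
  refine Metric.nhds_basis_closedBall.tendsto_right_iff.2 fun ε hε => ?_
  obtain ⟨B, -, hB⟩ := hF (ε / 2) (half_pos hε)
  have hGB (x : Site μ) : ‖G x - B x‖ ≤ ε / 2 :=
    le_of_tendsto ((hG x).sub_const (B x)).norm ((tendsto_prodMk_interiorFilter x).eventually hB)
  filter_upwards [hB] with p hp
  rw [mem_closedBall_zero_iff, ← sub_sub_sub_cancel_right _ _ (B p.2)]
  exact (norm_sub_le _ _).trans (by linarith [hGB p.2])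

end IsUniformlyQuasiLocal

section FiniteRange

variable {h : Site μ → SpinAlgebra d μ} {R : ℕ} {N : ℝ}

theorem exists_uniformlyLocal_lie_localHamiltonian_eq
    (hR : ∀ y, h y ∈ localSubalgebra d (box y R)) (hN : ∀ y, ‖h y‖ ≤ N)
    {A : Site μ → SpinAlgebra d μ} (hA : A ∈ uniformlyLocal d μ) :
    ∃ B ∈ uniformlyLocal d μ,
      ∀ᶠ p in interiorFilter μ, ⁅localHamiltonian h p.1, A p.2⁆ = B p.2 := by
  classical
  obtain ⟨r, M, hrM⟩ := hA
  have hN0 : 0 ≤ N := (norm_nonneg _).trans (hN 0)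
  have hsub (x : Site μ) : ∀ y ∈ box x r, box y R ⊆ (finBox x (r + R) : Set (Site μ)) :=
    fun y hy => coe_finBox (μ := μ) x (r + R) ▸ box_subset_box hy
  refine ⟨fun x => ∑ y ∈ finBox x (r + R), ⁅h y, A x⁆,
    ⟨r + R + R, (2 * (r + R) + 1 : ℕ) ^ μ * (2 * N * M), fun x => ⟨?_, ?_⟩⟩, ?_⟩
  · refine sum_mem fun y hy => localSubalgebra_mono ?_ (lie_mem_localSubalgebra (hR y) (hrM x).1)
    exact Set.union_subset (box_subset_box (mem_finBox.1 hy)) (box_mono x (by lia))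
  · refine (norm_sum_le_of_le (f := fun y => ⁅h y, A x⁆) (n := fun _ => 2 * N * M) _
      fun y _ => (norm_lie_le _ _).trans ?_).trans_eq ?_
    · gcongr
      exacts [hN y, (hrM x).2]
    · rw [Finset.sum_const, card_finBox, nsmul_eq_mul, Nat.cast_pow]
  · filter_upwards [eventually_box_subset (r + R)] with p hp
    rw [← coe_finBox, Finset.coe_subset] at hp
    rw [lie_localHamiltonian_eq_sum hR (hrM p.2).1 p.1 (hsub p.2), Finset.inter_eq_right.2 hp]

theorem exists_uniformlyLocal_ad_localHamiltonian_pow_eq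
    (hR : ∀ y, h y ∈ localSubalgebra d (box y R)) (hN : ∀ y, ‖h y‖ ≤ N)
    {A : Site μ → SpinAlgebra d μ} (hA : A ∈ uniformlyLocal d μ) (n : ℕ) :
    ∃ B ∈ uniformlyLocal d μ, ∀ᶠ p in interiorFilter μ,
      (LieAlgebra.ad ℂ _ (localHamiltonian h p.1) ^ n) (A p.2) = B p.2 := by
  induction n generalizing A with
  | zero => exact ⟨A, hA, .of_forall fun _ => rfl⟩
  | succ n ih =>
    obtain ⟨A', hA', hAA'⟩ := exists_uniformlyLocal_lie_localHamiltonian_eq hR hN hA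
    obtain ⟨B, hB, hA'B⟩ := ih hA'
    refine ⟨B, hB, ?_⟩
    filter_upwards [hAA', hA'B] with p hp hp'
    rw [pow_succ, Module.End.mul_apply, LieAlgebra.ad_apply, hp, hp']

theorem isUniformlyQuasiLocal_localEvolution_of_mem_uniformlyLocal
    (hR : ∀ y, h y ∈ localSubalgebra d (box y R)) (hN : ∀ y, ‖h y‖ ≤ N) {t : ℝ}
    (ht : |t| * (4 * N * ((2 * R + 1) ^ μ) ^ 2) ≤ 1 / 2)
    {A : Site μ → SpinAlgebra d μ} (hA : A ∈ uniformlyLocal d μ) :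
    IsUniformlyQuasiLocal fun p => localEvolution h p.1 t (A p.2) := by
  intro ε hε
  choose B hB hAB using exists_uniformlyLocal_ad_localHamiltonian_pow_eq hR hN hA
  obtain ⟨r, M, hrM⟩ := hA
  let a : ℕ → ℂ := fun n => (n.factorial : ℂ)⁻¹ * (Complex.I * t) ^ n
  let C : ℝ := 2 ^ (2 * r + 1) ^ μ * M
  have hterm (p : Finset (Site μ) × Site μ) (n : ℕ) :
      ‖a n • (LieAlgebra.ad ℂ _ (localHamiltonian h p.1) ^ n) (A p.2)‖ ≤ C * (1 / 2) ^ n := by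
    have hlocal : A p.2 ∈ localSubalgebra d (finBox p.2 r : Set (Site μ)) := by
      rw [coe_finBox]
      exact (hrM p.2).1
    refine (norm_commutatorSeries_term_le hR hN ht p.1 n hlocal).trans ?_
    rw [card_finBox]
    simp only [C]
    gcongr
    exact (hrM p.2).2
  have hremainder : Tendsto (fun k : ℕ => C * (1 / 2 : ℝ) ^ k / (1 - 1 / 2)) atTop (𝓝 0) := by
    simpa using ((tendsto_pow_atTop_nhds_zero_of_lt_one (r := (1 / 2 : ℝ)) (by norm_num)
      (by norm_num)).const_mul C).div_const (1 - 1 / 2)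
  obtain ⟨k, hk⟩ := (hremainder.eventually_le_const hε).exists
  refine ⟨∑ n ∈ Finset.range k, a n • B n, sum_mem fun n _ => Submodule.smul_mem _ _ (hB n), ?_⟩
  filter_upwards [(eventually_all_finset (Finset.range k)).2 fun n _ => hAB n] with p hp
  have hpartial : (∑ n ∈ Finset.range k, a n • B n) p.2 =
      ∑ n ∈ Finset.range k, a n • (LieAlgebra.ad ℂ _ (localHamiltonian h p.1) ^ n) (A p.2) := by
    simpa using Finset.sum_congr rfl fun n hn => by rw [hp n hn]
  rw [hpartial, norm_sub_rev]
  exact (norm_sub_le_of_geometric_bound_of_hasSum (by norm_num) (hterm p)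
    (hasSum_localEvolution h p.1 t (A p.2)) k).trans hk

theorem IsFiniteRange.exists_pos_isUniformlyQuasiLocal_localEvolution (hh : IsFiniteRange h) :
    ∃ δ > 0, ∀ t, |t| ≤ δ → ∀ F : Finset (Site μ) × Site μ → SpinAlgebra d μ,
      IsUniformlyQuasiLocal F → IsUniformlyQuasiLocal fun p => localEvolution h p.1 t (F p) := by
  obtain ⟨R, hR⟩ := hh.range
  obtain ⟨N, hN⟩ := hh.bounded
  have hN0 : 0 ≤ N := (norm_nonneg _).trans (hN 0)
  let κ : ℝ := 4 * N * ((2 * R + 1) ^ μ) ^ 2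
  have hκ : 0 ≤ κ := by positivity
  have hκ1 : 0 < 2 * (κ + 1) := by linarith
  refine ⟨1 / (2 * (κ + 1)), one_div_pos.2 hκ1, fun t ht F hF => .of_approx fun ε hε => ?_⟩
  have hsmall : |t| * κ ≤ 1 / 2 := by
    rw [le_div_iff₀ hκ1] at ht
    linarith [abs_nonneg t]
  obtain ⟨B, hB, hFB⟩ := hF ε hε
  refine ⟨_, isUniformlyQuasiLocal_localEvolution_of_mem_uniformlyLocal hR hN hsmall hB, ?_⟩
  filter_upwards [hFB] with p hp
  rw [← localEvolution_sub]
  exact (norm_localEvolution_le p.1 hh.selfAdjoint t _).trans hp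

theorem IsFiniteRange.isUniformlyQuasiLocal_localEvolution (hh : IsFiniteRange h)
    {F : Finset (Site μ) × Site μ → SpinAlgebra d μ} (hF : IsUniformlyQuasiLocal F) (t : ℝ) :
    IsUniformlyQuasiLocal fun p => localEvolution h p.1 t (F p) := by
  obtain ⟨δ, hδ, hsmall⟩ := hh.exists_pos_isUniformlyQuasiLocal_localEvolution
  obtain ⟨n, hn⟩ := exists_nat_gt (|t| / δ)
  have hn0 : (0 : ℝ) < n := (by positivity : 0 ≤ |t| / δ).trans_lt hn
  have hstep : |t / n| ≤ δ := by
    rw [abs_div, abs_of_pos hn0, div_le_iff₀ hn0, ← div_le_iff₀' hδ]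
    exact hn.le
  have hiterate (k : ℕ) :
      IsUniformlyQuasiLocal fun p => localEvolution h p.1 (k * (t / n)) (F p) := by
    induction k with
    | zero => simpa [localEvolution_zero] using hF
    | succ k ih =>
      simpa [add_mul, add_comm, localEvolution_add] using hsmall _ hstep _ ih
  simpa [mul_div_cancel₀ t hn0.ne'] using hiterate n

theorem tendsto_localEvolution_spaceAverage_sub (hh : IsFiniteRange h)
    {α : ℝ → (SpinAlgebra d μ ≃⋆ₐ[ℂ] SpinAlgebra d μ)} (hinv : IsTranslationInvariant α)
    (happ : IsApproximatelyInner h α) (t : ℝ) (A : SpinAlgebra d μ) :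
    Tendsto (fun Λ => localEvolution h Λ t (spaceAverage Λ A) - spaceAverage Λ (α t A))
      (vanHove μ) (𝓝 0) := by
  have hinterior : Tendsto (fun p : Finset (Site μ) × Site μ =>
      localEvolution h p.1 t (translation p.2 A) - translation p.2 (α t A))
      (interiorFilter μ) (𝓝 0) := by
    refine (hh.isUniformlyQuasiLocal_localEvolution (.translation A) t).tendsto_sub_of_tendsto
      (G := fun x => translation x (α t A)) fun x => ?_
    rw [← hinv]
    exact happ t (translation x A)
  have hbound (p : Finset (Site μ) × Site μ) :
      ‖localEvolution h p.1 t (translation p.2 A) - translation p.2 (α t A)‖ ≤ ‖A‖ + ‖α t A‖ :=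
    norm_sub_le_of_le
      ((norm_localEvolution_le p.1 hh.selfAdjoint t _).trans (norm_translation_le p.2 A))
      (norm_translation_le p.2 _)
  refine (tendsto_inv_card_smul_sum_vanHove hbound hinterior).congr fun Λ => ?_
  rw [localEvolution_spaceAverage, spaceAverage, Finset.sum_sub_distrib, smul_sub]

end FiniteRange

/-! ### Temporal correlations -/

theorem mainTheorem5_general (hμ : 1 ≤ μ) {h : Site μ → SpinAlgebra d μ} (hh : IsFiniteRange h)
    {α : ℝ → (SpinAlgebra d μ ≃⋆ₐ[ℂ] SpinAlgebra d μ)} (hinv : IsTranslationInvariant α)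
    (happ : IsApproximatelyInner h α) (A B : SpinAlgebra d μ)
    {ι : Type*} {l : Filter ι} {ρ : ι → SpinAlgebra d μ → ℂ} {φ : SpinAlgebra d μ →ₗ[ℂ] ℂ}
    (hρ : ∀ C, Tendsto (fun i => ρ i C) l (𝓝 (φ C))) (hhom : IsHomogeneous φ)
    {E : Type*} [NormedAddCommGroup E] [InnerProductSpace ℂ E] [CompleteSpace E]
    {π : SpinAlgebra d μ →⋆ₐ[ℂ] (E →L[ℂ] E)} {Ω : E} (hGNS : IsGNSTriple φ π Ω) :
    ∃ f : ℝ → ℂ, ∀ t : ℝ,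
      temporalCorrelations π Ω α A B t = {f t} ∧
      ∃ g : Finset (Site μ) → ℂ,
        (∀ Λ, Tendsto
          (fun i => ρ i (localEvolution h Λ t (spaceAverage Λ A) * spaceAverage Λ B)) l
          (𝓝 (g Λ))) ∧
        Tendsto g (vanHove μ) (𝓝 (f t)) := by
  choose a ha using hGNS.exists_forall_tendsto_spaceAverage hμ hhom
  refine ⟨fun t => inner ℂ Ω (a (α t A) (a B Ω)), fun t =>
    ⟨temporalCorrelations_eq_singleton (ha _) (ha _), _, fun Λ => hρ _, ?_⟩⟩
  have hmain : Tendsto (fun Λ => π (spaceAverage Λ (α t A)) (π (spaceAverage Λ B) Ω)) (vanHove μ)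
      (𝓝 (a (α t A) (a B Ω))) :=
    tendsto_apply_of_bounded (fun Λ => norm_map_spaceAverage_le π Λ _) (ha _) (ha B Ω)
  have herror : Tendsto (fun Λ => π (localEvolution h Λ t (spaceAverage Λ A) -
      spaceAverage Λ (α t A)) (π (spaceAverage Λ B) Ω)) (vanHove μ) (𝓝 0) := by
    refine squeeze_zero_norm (fun Λ => norm_starAlgHom_apply_le π _ _) ?_
    simpa using (tendsto_localEvolution_spaceAverage_sub hh hinv happ t A).norm.mul (ha B Ω).norm
  have hsum := hmain.add herror
  rw [add_zero] at hsum
  refine (tendsto_const_nhds.inner hsum).congr fun Λ => ?_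
  rw [hGNS.vector_state]
  simp

theorem mainTheorem5 {d μ : ℕ} (hd : 1 ≤ d) (hμ : 1 ≤ μ)
    (h : Site μ → SpinAlgebra d μ) (hh : IsFiniteRange h)
    (α : ℝ → (SpinAlgebra d μ ≃⋆ₐ[ℂ] SpinAlgebra d μ)) (hα : IsCStarDynamics α)
    (hinv : IsTranslationInvariant α) (happ : IsApproximatelyInner h α)
    (β : ℝ) (hβ : 0 ≤ β)
    (A₀ B₀ : SpinAlgebra d μ) (hA : IsLocal A₀) (hB : IsLocal B₀)
    -- `φ` is a limiting Gibbs state: the limit of the local Gibbs states along `l₁`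
    (l₁ : Filter (Finset (Site μ))) [l₁.NeBot] (hl₁ : l₁ ≤ Filter.atTop)
    (φ : SpinAlgebra d μ →ₗ[ℂ] ℂ) (hφ : IsState φ)
    (hlim : ∀ A, Filter.Tendsto (fun Λ => gibbsState h β Λ A) l₁ (nhds (φ A)))
    (hhom : IsHomogeneous φ)
    {E : Type*} [NormedAddCommGroup E] [InnerProductSpace ℂ E] [CompleteSpace E]
    (π : SpinAlgebra d μ →⋆ₐ[ℂ] (E →L[ℂ] E)) (Ω : E) (hGNS : IsGNSTriple φ π Ω) :
    ∃ f : ℝ → ℂ, ∀ t : ℝ,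
      temporalCorrelations π Ω α A₀ B₀ t = {f t} ∧
      ∃ g : Finset (Site μ) → ℂ,
        (∀ Λ₂, Filter.Tendsto
          (fun Λ₁ => gibbsState h β Λ₁
            (localEvolution h Λ₂ t (spaceAverage Λ₂ A₀) * spaceAverage Λ₂ B₀)) l₁ (nhds (g Λ₂))) ∧
        Filter.Tendsto g (vanHove μ) (nhds (f t)) :=
  mainTheorem5_general hμ hh hinv happ A₀ B₀ hlim hhom hGNS
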